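/- **Setting.** Consider a finite two-player zero-sum extensive-form game with chance moves and perfect recall. For player $i\in\{1,2\}$ let $\mathcal I_i$ be the information sets, $A(I)\neq\emptyset$ the actions at $I$, $\Sigma_i=\{\emptyset\}\cup\{Ia\}$ the sequences, $pI\in\Sigma_i$ the parent sequence of $I$ (the last own sequence before $I$), and $\boldsymbol U\in\mathbb R^{\Sigma_1\times\Sigma_2}$ the matrix whose entry at $(\sigma_1,\sigma_2)$ is the sum of (chance probability)$\times$(utility of player 1) over the leaves with last sequences $\sigma_1,\sigma_2$. Fix $\mu>0$ and $\epsilon>0$ with $\epsilon|A(I)|\le 1$ for every $I$. Let $\mathcal Q_i^\epsilon$ be the set of $\boldsymbol q_i\in\mathbb R^{\Sigma_i}$ with $\boldsymbol q_i[\emptyset]=1$, $\sum_a\boldsymbol q_i[Ia]=\boldsymbol q_i[pI]$ and behavioral probabilities $\boldsymbol x_i[Ia]=\boldsymbol q_i[Ia]/\boldsymbol q_i[pI]\ge\epsilon$; write $\mathcal Q^\epsilon=\mathcal Q^\epsilon_1\times\mathcal Q^\epsilon_2$. An $\epsilon$-EFPE is a Nash equilibrium of the perturbed game $(\mathcal Q_1^\epsilon,\mathcal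 Q_2^\epsilon,\boldsymbol U)$, in which player 1 maximizes and player 2 minimizes $\boldsymbol q_1^\top\boldsymbol U\boldsymbol q_2$. The counterfactual values of $\boldsymbol q=(\boldsymbol q_1,\boldsymbol q_2)$ are $\boldsymbol v_i[Ia]=(\boldsymbol U_i\boldsymbol q_{-i})[Ia]+\sum_{I'a':\,pI'=Ia}\boldsymbol x_i[I'a']\,\boldsymbol v_i[I'a']$, where $\boldsymbol U_1=\boldsymbol U$, $\boldsymbol U_2=-\boldsymbol U^\top$. **Regularized problems.** A saddle point of the reward-transformed problem with reference $\boldsymbol q^r\in\mathcal Q^\epsilon$ (behavioral form $\boldsymbol x^r$) is a profile $\boldsymbol q\in\mathcal Q^\epsilon$ such that, for both players $i$ and every $I\in\mathcal I_i$, the local strategy $\boldsymbol x_i(I)$ maximizes $\langle\boldsymbol v_i(I),y\rangle-\frac\mu2\|y-\boldsymbol x_i^r(I)\|_2^2$ over $\Delta_\epsilon(I)=\{y\in\mathbb R^{A(I)}: y\ge\epsilon,\ \sum_a y_a=1\}$, where $\boldsymbol v$ are the counterfactual values of $\boldsymbol q$. **RTCFR.** Let $\boldsymbol B(I)$ be the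 matrix whose $j$-th column is the vertex of $\Delta_\epsilon(I)$ with entry $\tau_I+\epsilon$ at $j$ and $\epsilon$ elsewhere, $\tau_I=1-\epsilon|A(I)|$. One block of RTCFR with reference $\boldsymbol x^r$ and initial cumulative regrets $\boldsymbol R^0$ performs, for $t=1,2,\dots$, simultaneously at all information sets of both players: $\hat{\boldsymbol x}^t(I)=[\boldsymbol R^{t-1}(I)]^+/\|[\boldsymbol R^{t-1}(I)]^+\|_1$ (uniform if the denominator is $0$), $\boldsymbol x^t(I)=\boldsymbol B(I)\hat{\boldsymbol x}^t(I)$, $\tilde{\boldsymbol v}^t(I)=\boldsymbol v^t(I)+\mu(\boldsymbol x^r(I)-\boldsymbol x^t(I))$, $\boldsymbol r^t(I)=\boldsymbol B(I)^\top\tilde{\boldsymbol v}^t(I)-\langle\boldsymbol B(I)^\top\tilde{\boldsymbol v}^t(I),\hat{\boldsymbol x}^t(I)\rangle\boldsymbol 1$, where $\boldsymbol v^t$ are the counterfactual values of $\boldsymbol x^t$. With $\boldsymbol Y=\boldsymbol R^{t-1}+\boldsymbol r^t$, the new cumulative regret $\boldsymbol R^t$ is $\boldsymbol Y$ (RM),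 $[\boldsymbol Y]^+$ (RM+), or $\frac{t^\alpha}{t^\alpha+1}[\boldsymbol Y]^++\frac{t^\beta}{t^\beta+1}[\boldsymbol Y]^-$ (discounted RM, $\alpha>1$, $\beta\in\mathbb R$), where $[\cdot]^+=\max(\cdot,0)$ and $[\cdot]^-=\min(\cdot,0)$. The iterate $\boldsymbol q^t$ is the sequence form of $\boldsymbol x^t$. **Theorem (Asymptotic last-iterate convergence of RTCFR).** Let $\boldsymbol q^{r,n}\in\mathcal Q^\epsilon$ be the reference of the $n$-th block ($n\ge1$) and $\boldsymbol q^{*,n}$ a saddle point of the $n$-th reward-transformed problem. Suppose that the reference is reset to the final iterate of the previous block in the idealization $T\to\infty$, that is $\boldsymbol q^{r,n+1}=\boldsymbol q^{*,n}$ for all $n$; or, more generally, that $\sum_n\|\boldsymbol q^{r,n+1}-\boldsymbol q^{*,n}\|_2<\infty$. Then $(\boldsymbol q^{*,n})_n$ is bounded and converges to an $\epsilon$-EFPE $\boldsymbol q^*$. Moreover, for each of the three regret rules, and for arbitrary initial cumulative regrets in each block (in particular those carried over from the previous block after any number of iterations), the RTCFR iterates $\boldsymbol q^{t,n}$ of the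 $n$-th block, run with reference $\boldsymbol q^{r,n}$, satisfy $\boldsymbol q^{t,n}\to\boldsymbol q^{*,n}$ as $t\to\infty$ for all sufficiently large $n$, and $\lim_{n\to\infty}\limsup_{t\to\infty}\|\boldsymbol q^{t,n}-\boldsymbol q^*\|_2=0$. -/

import Mathlib

open Filter Topology Matrix

/-! Two-player zero-sum extensive-form games. Players are `0` and `1 : Fin 2`; player `0` receives
the utility of the reached leaf and player `1` its negative. `I i` is the type of information sets
of player `i`, and `A i J` is the set of actions available at the information set `J`. -/

/-- A finite game tree: terminal states, chance states and decision states. Two decision states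
with the same label `J` are indistinguishable for the player who acts there; they have the same
actions by construction. -/
inductive GameTree {I : Fin 2 → Type*} (A : (i : Fin 2) → I i → Type*) where
  | leaf (u : ℝ) : GameTree A
  | chance (k : ℕ) (p : Fin k → ℝ) (child : Fin k → GameTree A) : GameTree A
  | node (i : Fin 2) (J : I i) (child : A i J → GameTree A) : GameTree A

/-- `Visits T h S`: the state (subtree) `S` occurs in `T`, and on the path from the root of `T` to
it player `i` has taken the information set / action pairs of `h i` (most recent first). -/
inductive Visits {I : Fin 2 → Type*} {A : (i : Fin 2) → I i → Type*} (T : GameTree A) :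
    ((i : Fin 2) → List (Σ J : I i, A i J)) → GameTree A → Prop where
  | root : Visits T (fun _ => []) T
  | chance {h : (i : Fin 2) → List (Σ J : I i, A i J)} {k : ℕ} {p : Fin k → ℝ}
      {c : Fin k → GameTree A} (hv : Visits T h (GameTree.chance k p c)) (j : Fin k) :
      Visits T h (c j)
  | node {h : (i : Fin 2) → List (Σ J : I i, A i J)} {i : Fin 2} {J : I i}
      {c : A i J → GameTree A} (hv : Visits T h (GameTree.node i J c)) (a : A i J) :
      Visits T (Function.update h i (⟨J, a⟩ :: h i)) (c a)

/-- A two-player zero-sum extensive-form game with perfect recall. -/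
structure EFG {I : Fin 2 → Type*} (A : (i : Fin 2) → I i → Type*) where
  /-- the game tree -/
  tree : GameTree A
  /-- chance moves are drawn from probability distributions -/
  chance_law : ∀ (h : (i : Fin 2) → List (Σ J : I i, A i J)) (k : ℕ) (p : Fin k → ℝ)
    (c : Fin k → GameTree A), Visits tree h (GameTree.chance k p c) →
      (∀ j, 0 ≤ p j) ∧ ∑ j, p j = 1
  /-- information sets are nonempty -/
  occurs : ∀ (i : Fin 2) (J : I i), ∃ (h : (i : Fin 2) → List (Σ J : I i, A i J))
    (c : A i J → GameTree A), Visits tree h (GameTree.node i J c)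
  /-- the own history of player `i` (most recent pair first) when acting at `J` -/
  hist : (i : Fin 2) → I i → List (Σ J : I i, A i J)
  /-- perfect recall: all states of an information set share the same own history -/
  perfect_recall : ∀ (h : (i : Fin 2) → List (Σ J : I i, A i J)) (i : Fin 2) (J : I i)
    (c : A i J → GameTree A), Visits tree h (GameTree.node i J c) → h i = hist i J

/-- The sequences of player `i`: the empty sequence `none`, and `some ⟨J, a⟩`. -/
abbrev ActSeq {I : Fin 2 → Type*} (A : (i : Fin 2) → I i → Type*) (i : Fin 2) :=
  Option (Σ J : I i, A i J)

/-- Pairs of vectors indexed by sequences (sequence-form strategy profiles live here). -/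
abbrev SeqProfile {I : Fin 2 → Type*} (A : (i : Fin 2) → I i → Type*) :=
  (i : Fin 2) → ActSeq A i → ℝ

/-- Pairs of vectors indexed by the actions at the information sets (behavioral strategy profiles,
regrets, values). -/
abbrev LocalProfile {I : Fin 2 → Type*} (A : (i : Fin 2) → I i → Type*) :=
  (i : Fin 2) → (J : I i) → A i J → ℝ

/-- Euclidean distance of two profiles. -/
noncomputable def profileDist {I : Fin 2 → Type*} {A : (i : Fin 2) → I i → Type*}
    [∀ i, Fintype (I i)] [∀ i J, Fintype (A i J)] (p q : SeqProfile A) : ℝ :=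
  Real.sqrt (∑ i, ∑ σ, (p i σ - q i σ) ^ 2)

open Classical in
/-- The utility matrix of the tree `T`, entered when the last own sequences of the players are
`cur`: the entry at `(σ₀, σ₁)` is the sum, over the leaves at which these are the last sequences of
the players, of the chance probability of the path to the leaf times the utility of the leaf. -/
noncomputable def GameTree.payoff {I : Fin 2 → Type*} {A : (i : Fin 2) → I i → Type*}
    [∀ i J, Fintype (A i J)] :
    GameTree A → ((i : Fin 2) → ActSeq A i) → Matrix (ActSeq A 0) (ActSeq A 1) ℝ
  | .leaf u, cur => Matrix.of fun σ₀ σ₁ => if cur 0 = σ₀ ∧ cur 1 = σ₁ then u else 0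
  | .chance _ p c, cur => ∑ j, p j • (c j).payoff cur
  | .node i J c, cur => ∑ a, (c a).payoff (Function.update cur i (some ⟨J, a⟩))

/-- The `ε`-perturbed simplex over a finite set of actions. -/
def perturbedSimplex (S : Type*) [Fintype S] (ε : ℝ) : Set (S → ℝ) :=
  {y | (∀ a, ε ≤ y a) ∧ ∑ a, y a = 1}

open Classical in
/-- The basis matrix of the `ε`-perturbed simplex: its column `j` is the vertex
`(ε, …, τ + ε, …, ε)` with `τ = 1 - |S| ε`. -/
noncomputable def basisMatrix (S : Type*) [Fintype S] (ε : ℝ) : Matrix S S ℝ :=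
  Matrix.of fun a j => ε + if a = j then 1 - (Fintype.card S : ℝ) * ε else 0

/-- Regret matching: proportional to the positive parts, uniform if there is none. -/
noncomputable def regretMatching {S : Type*} [Fintype S] (R : S → ℝ) : S → ℝ := fun a =>
  if 0 < ∑ b, max (R b) 0 then max (R a) 0 / ∑ b, max (R b) 0 else 1 / (Fintype.card S : ℝ)

/-- The local regret minimizers: regret matching, regret matching plus, and discounted regret
matching with parameters `α` (positive regrets) and `β` (negative regrets). -/
inductive RegretRule where
  | rm : RegretRule
  | rmPlus : RegretRule
  | discounted (α β : ℝ) : RegretRule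

/-- The new cumulative regret at iteration `t`, where `Y` is the old cumulative regret plus the
instantaneous regret. -/
noncomputable def RegretRule.update : RegretRule → ℕ → ℝ → ℝ
  | .rm, _, Y => Y
  | .rmPlus, _, Y => max Y 0
  | .discounted α β, t, Y =>
      (t : ℝ) ^ α / ((t : ℝ) ^ α + 1) * max Y 0 + (t : ℝ) ^ β / ((t : ℝ) ^ β + 1) * min Y 0

/-- No condition on regret matching (plus); for the discounted rule the total discount of the
positive regrets is finite. -/
def RegretRule.Admissible : RegretRule → Prop
  | .rm => True
  | .rmPlus => True
  | .discounted α _ => 1 < α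

namespace EFG

/-- The parent sequence of an information set: the last own sequence before it. -/
def parent {I : Fin 2 → Type*} {A : (i : Fin 2) → I i → Type*} (G : EFG A) (i : Fin 2)
    (J : I i) : ActSeq A i :=
  (G.hist i J).head?

theorem exists_visits_of_cons {I : Fin 2 → Type*} {A : (i : Fin 2) → I i → Type*}
    {T S : GameTree A} {h : (i : Fin 2) → List (Σ J : I i, A i J)} (hv : Visits T h S)
    (i : Fin 2) (σ : Σ J : I i, A i J) (l : List (Σ J : I i, A i J)) (hl : h i = σ :: l) :
    ∃ (h' : (i : Fin 2) → List (Σ J : I i, A i J)) (c : A i σ.1 → GameTree A),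
      Visits T h' (GameTree.node i σ.1 c) ∧ h' i = l := by
  induction hv with
  | root => simp at hl
  | chance _ _ ih => exact ih hl
  | @node h j J c hv a ih =>
    by_cases hij : i = j
    · subst hij
      simp only [Function.update_self, List.cons.injEq] at hl
      obtain ⟨rfl, rfl⟩ := hl
      exact ⟨h, c, hv, rfl⟩
    · rw [Function.update_of_ne hij] at hl
      exact ih hl

theorem hist_eq_of_parent {I : Fin 2 → Type*} {A : (i : Fin 2) → I i → Type*} (G : EFG A)
    (i : Fin 2) (J : I i) (σ : Σ J : I i, A i J) (hp : G.parent i J = some σ) :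
    G.hist i J = σ :: G.hist i σ.1 := by
  obtain ⟨h, c, hv⟩ := G.occurs i J
  obtain ⟨l, hl⟩ : ∃ l, G.hist i J = σ :: l := by
    unfold parent at hp
    cases hh : G.hist i J with
    | nil => simp [hh] at hp
    | cons b l =>
      simp only [hh, List.head?_cons, Option.some.injEq] at hp
      exact ⟨l, by rw [hp]⟩
  obtain ⟨h', c', hv', rfl⟩ :=
    exists_visits_of_cons hv i σ l ((G.perfect_recall h i J c hv).trans hl)
  rw [hl, G.perfect_recall h' i σ.1 c' hv']

/-- The utility matrix of the game. -/
noncomputable def U {I : Fin 2 → Type*} {A : (i : Fin 2) → I i → Type*}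
    [∀ i J, Fintype (A i J)] (G : EFG A) : Matrix (ActSeq A 0) (ActSeq A 1) ℝ :=
  G.tree.payoff fun _ => none

/-- The sequence-form strategy polytope of player `i` in the `ε`-perturbed game: realization plans
whose behavioral probabilities are all at least `ε`. -/
def polytope {I : Fin 2 → Type*} {A : (i : Fin 2) → I i → Type*}
    [∀ i J, Fintype (A i J)] (G : EFG A) (ε : ℝ) (i : Fin 2) : Set (ActSeq A i → ℝ) :=
  {q | q none = 1 ∧ (∀ J, ∑ a, q (some ⟨J, a⟩) = q (G.parent i J)) ∧
    ∀ J a, ε * q (G.parent i J) ≤ q (some ⟨J, a⟩)}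

/-- Sequence-form strategy profiles of the `ε`-perturbed game. -/
def IsProfile {I : Fin 2 → Type*} {A : (i : Fin 2) → I i → Type*}
    [∀ i J, Fintype (A i J)] (G : EFG A) (ε : ℝ) (q : SeqProfile A) : Prop :=
  ∀ i, q i ∈ G.polytope ε i

/-- An `ε`-EFPE: a Nash equilibrium of the `ε`-perturbed game. -/
def IsEFPE {I : Fin 2 → Type*} {A : (i : Fin 2) → I i → Type*}
    [∀ i, Fintype (I i)] [∀ i J, Fintype (A i J)] (G : EFG A) (ε : ℝ)
    (q : SeqProfile A) : Prop :=
  G.IsProfile ε q ∧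
    (∀ p ∈ G.polytope ε 0, p ⬝ᵥ G.U *ᵥ q 1 ≤ q 0 ⬝ᵥ G.U *ᵥ q 1) ∧
    ∀ p ∈ G.polytope ε 1, q 0 ⬝ᵥ G.U *ᵥ q 1 ≤ q 0 ⬝ᵥ G.U *ᵥ p

/-- The sequence form of a behavioral strategy profile: the product of the action probabilities
along the own path. -/
def toSeq {I : Fin 2 → Type*} {A : (i : Fin 2) → I i → Type*} (G : EFG A)
    (x : LocalProfile A) : SeqProfile A := fun i σ =>
  match σ with
  | none => 1
  | some σ => ((σ :: G.hist i σ.1).map fun ρ => x i ρ.1 ρ.2).prod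

/-- The behavioral form of a sequence-form strategy profile. -/
noncomputable def toBehav {I : Fin 2 → Type*} {A : (i : Fin 2) → I i → Type*} (G : EFG A)
    (q : SeqProfile A) : LocalProfile A := fun i J a =>
  q i (some ⟨J, a⟩) / q i (G.parent i J)

/-- `U_i q_{-i}`, the utility vector of player `i` against the opponent's strategy in `q`. -/
noncomputable def grad {I : Fin 2 → Type*} {A : (i : Fin 2) → I i → Type*}
    [∀ i, Fintype (I i)] [∀ i J, Fintype (A i J)] (G : EFG A) (q : SeqProfile A) :
    (i : Fin 2) → ActSeq A i → ℝ
  | 0 => G.U *ᵥ q 1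
  | 1 => -(q 0 ᵥ* G.U)

open Classical in
/-- Backward recursion for counterfactual values:
`v[Ja] = g[Ja] + ∑_{J'a' : pJ' = Ja} x[J'a'] v[J'a']`. -/
noncomputable def backValue {I : Fin 2 → Type*} {A : (i : Fin 2) → I i → Type*}
    [∀ i, Fintype (I i)] [∀ i J, Fintype (A i J)] (G : EFG A) (i : Fin 2)
    (g : ActSeq A i → ℝ) (x : (J : I i) → A i J → ℝ) (σ : Σ J : I i, A i J) : ℝ :=
  g (some σ) + ∑ J' : I i, if _hp : G.parent i J' = some σ then
    ∑ a' : A i J', x J' a' * G.backValue i g x ⟨J', a'⟩ else 0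
termination_by (Finset.univ.sup fun J : I i => (G.hist i J).length) - (G.hist i σ.1).length
decreasing_by
  have h1 : (G.hist i J').length = (G.hist i σ.1).length + 1 := by
    rw [G.hist_eq_of_parent i J' σ _hp, List.length_cons]
  have h2 : (G.hist i J').length ≤ Finset.univ.sup fun J : I i => (G.hist i J).length :=
    Finset.le_sup (f := fun J : I i => (G.hist i J).length) (Finset.mem_univ J')
  omega

/-- Counterfactual values of the behavioral profile `x`. -/
noncomputable def cfValue {I : Fin 2 → Type*} {A : (i : Fin 2) → I i → Type*}
    [∀ i, Fintype (I i)] [∀ i J, Fintype (A i J)] (G : EFG A) (x : LocalProfile A) :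
    LocalProfile A := fun i J a =>
  G.backValue i (G.grad (G.toSeq x) i) (x i) ⟨J, a⟩

/-- `q` is a saddle point of the reward-transformed problem with weight `μ` and reference `qr` in
the `ε`-perturbed game: at every information set `J` of either player, the behavioral strategy
`x(J)` of `q` maximizes `⟨v(J), y⟩ - μ/2 ‖y - xr(J)‖²` over the perturbed simplex, where `v` are the
counterfactual values of `q`. -/
def IsRTSaddle {I : Fin 2 → Type*} {A : (i : Fin 2) → I i → Type*}
    [∀ i, Fintype (I i)] [∀ i J, Fintype (A i J)] (G : EFG A) (ε μ : ℝ)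
    (qr q : SeqProfile A) : Prop :=
  G.IsProfile ε q ∧
    ∀ (i : Fin 2) (J : I i), IsMaxOn
      (fun y : A i J → ℝ => ∑ a, G.cfValue (G.toBehav q) i J a * y a
        - μ / 2 * ∑ a, (y a - G.toBehav qr i J a) ^ 2)
      (perturbedSimplex (A i J) ε) (G.toBehav q i J)

/-- The behavioral profile `x = B x̂` played when the cumulative regrets are `R`. -/
noncomputable def play {I : Fin 2 → Type*} {A : (i : Fin 2) → I i → Type*}
    [∀ i J, Fintype (A i J)] (ε : ℝ) (R : LocalProfile A) : LocalProfile A := fun i J =>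
  basisMatrix (A i J) ε *ᵥ regretMatching (R i J)

/-- The reward-transformed counterfactual values `v + μ (xr - x)`. -/
noncomputable def rtValue {I : Fin 2 → Type*} {A : (i : Fin 2) → I i → Type*}
    [∀ i, Fintype (I i)] [∀ i J, Fintype (A i J)] (G : EFG A) (μ : ℝ)
    (xr x : LocalProfile A) : LocalProfile A := fun i J a =>
  G.cfValue x i J a + μ * (xr i J a - x i J a)

/-- The instantaneous regrets in the perturbed coordinates, `Bᵀ ṽ - ⟨Bᵀ ṽ, x̂⟩ 1`, when the
cumulative regrets are `R`. -/
noncomputable def instRegret {I : Fin 2 → Type*} {A : (i : Fin 2) → I i → Type*}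
    [∀ i, Fintype (I i)] [∀ i J, Fintype (A i J)] (G : EFG A) (ε μ : ℝ)
    (xr R : LocalProfile A) : LocalProfile A := fun i J j =>
  ((basisMatrix (A i J) ε)ᵀ *ᵥ G.rtValue μ xr (play ε R) i J) j
    - ((basisMatrix (A i J) ε)ᵀ *ᵥ G.rtValue μ xr (play ε R) i J) ⬝ᵥ regretMatching (R i J)

/-- The cumulative regrets of RTCFR after `t` iterations of one block with reference `xr`, started
from the cumulative regrets `R0`. -/
noncomputable def regrets {I : Fin 2 → Type*} {A : (i : Fin 2) → I i → Type*}
    [∀ i, Fintype (I i)] [∀ i J, Fintype (A i J)] (G : EFG A) (rule : RegretRule) (ε μ : ℝ)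
    (xr R0 : LocalProfile A) : ℕ → LocalProfile A
  | 0 => R0
  | t + 1 => fun i J a => rule.update (t + 1)
      (G.regrets rule ε μ xr R0 t i J a + G.instRegret ε μ xr (G.regrets rule ε μ xr R0 t) i J a)

/-- The sequence-form RTCFR iterate after `t` iterations of one block with reference `qr`, started
from the cumulative regrets `R0` (the iterate numbered `t + 1` when the first one has number 1). -/
noncomputable def iterate {I : Fin 2 → Type*} {A : (i : Fin 2) → I i → Type*}
    [∀ i, Fintype (I i)] [∀ i J, Fintype (A i J)] (G : EFG A) (rule : RegretRule) (ε μ : ℝ)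
    (qr : SeqProfile A) (R0 : LocalProfile A) (t : ℕ) : SeqProfile A :=
  G.toSeq (play ε (G.regrets rule ε μ (G.toBehav qr) R0 t))

end EFG

/-!
Everything is done in behavioral coordinates `x`, on the compact convex product of the perturbed
simplices, where realization probabilities are bounded away from zero and both the sequence form and
the counterfactual values are `C¹`, hence Lipschitz. The maximization property of a saddle point
enters only through its first order condition `EFG.LocalVI`. Local and global regrets are linked by
`EFG.sum_toSeq_mul_cfValue`: the regret of a profile `x` against `z` is the sum of the local regrets
weighted by the realization probabilities of `z`.

*Across blocks.* Let `z` be an equilibrium of the perturbed game (one exists by the minimax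
theorem). Since the game is zero-sum, the first order condition and the regret decomposition give
`D(x) + D(x, xr) ≤ D(xr)` for the solution `x` with reference `xr`, where `D` is the squared distance
(to `z` if only one argument is shown) weighted by the realization probabilities of `z`
(`EFG.LocalVI.weightedSqDist_add_le`). So the saddle points are quasi-Fejér monotone, their distances
to their references tend to zero, every limit point is locally optimal at every information set and
therefore an equilibrium, and the whole sequence converges to it
(`EFG.exists_tendsto_of_localVI`).

*Within a block.* The counterfactual values are not monotone in behavioral coordinates: the weights
in the decompositions of the regret of `x` against the saddle point `z`, and of `z` against `x`,
differ. The difference is at most a constant times the distance of `z` to the reference times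
`‖x - z‖²`, so once the reference is close to the saddle point, which holds for all late blocks, the
weighted reward-transformed regret of `x` against `z` is at least `c ‖x - z‖²`
(`EFG.exists_strong_localVI`).

All three regret rules satisfy the same two inequalities
(`RegretRule.Admissible.exists_discount`). Together with the orthogonality of the instantaneous
regrets to the positive parts of the cumulative ones they make a quadratic potential decrease by
`‖x - z‖²` in each iteration, up to summable errors (`summable_sq_of_regret_dynamics`). The potential
has a linear term in the direction of the solution, which turns the lower bound on the regret into
decrease, and one on the coordinates where the solution has negative regret, which pays for the
squared regrets that do not vanish at the solution. Hence `∑ ‖xᵗ - z‖² < ∞`.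
-/

/-! ### Sequence form and behavioral form -/

namespace EFG

variable {I : Fin 2 → Type*} {A : (i : Fin 2) → I i → Type*}

theorem toSeq_some (G : EFG A) (x : LocalProfile A) (i : Fin 2) (J : I i) (a : A i J) :
    G.toSeq x i (some ⟨J, a⟩) = G.toSeq x i (G.parent i J) * x i J a := by
  have key : G.toSeq x i (G.parent i J) = ((G.hist i J).map fun ρ => x i ρ.1 ρ.2).prod := by
    cases hp : G.parent i J with
    | none =>
      have : G.hist i J = [] := by simpa [parent] using hp
      simp [this, toSeq]
    | some σ => rw [G.hist_eq_of_parent i J σ hp]; rfl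
  rw [key, mul_comm]
  simp [toSeq]

/-- Induction along own sequences, from the empty sequence downwards. -/
theorem seq_induction (G : EFG A) (i : Fin 2) {P : ActSeq A i → Prop} (h0 : P none)
    (hs : ∀ J a, P (G.parent i J) → P (some ⟨J, a⟩)) (σ : ActSeq A i) : P σ := by
  have key : ∀ n : ℕ, ∀ J : I i, (G.hist i J).length = n → ∀ a, P (some ⟨J, a⟩) := by
    intro n
    induction n with
    | zero =>
      intro J hJ a
      apply hs
      have : G.hist i J = [] := List.length_eq_zero_iff.1 hJ
      simpa [parent, this] using h0
    | succ n ih =>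
      intro J hJ a
      apply hs
      cases hp : G.parent i J with
      | none => exact h0
      | some σ =>
        rw [G.hist_eq_of_parent i J σ hp, List.length_cons] at hJ
        exact ih σ.1 (by omega) σ.2
  rcases σ with _ | ⟨J, a⟩
  · exact h0
  · exact key _ J rfl a

/-- Induction along own sequences, from the last information sets upwards. -/
theorem seq_backward_induction [∀ i, Fintype (I i)] (G : EFG A) (i : Fin 2)
    {P : (Σ J : I i, A i J) → Prop}
    (hs : ∀ σ, (∀ J a, G.parent i J = some σ → P ⟨J, a⟩) → P σ) (σ : Σ J : I i, A i J) : P σ := by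
  have key : ∀ n : ℕ, ∀ σ : Σ J : I i, A i J,
      (Finset.univ.sup fun J : I i => (G.hist i J).length) - (G.hist i σ.1).length = n → P σ := by
    intro n
    induction n using Nat.strong_induction_on with
    | _ n ih =>
      intro σ hσ
      refine hs σ fun J a hp => ih _ ?_ ⟨J, a⟩ rfl
      have h1 : (G.hist i J).length = (G.hist i σ.1).length + 1 := by
        rw [G.hist_eq_of_parent i J σ hp, List.length_cons]
      have h2 : (G.hist i J).length ≤ Finset.univ.sup fun J : I i => (G.hist i J).length :=
        Finset.le_sup (f := fun J : I i => (G.hist i J).length) (Finset.mem_univ J)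
      dsimp only
      omega
  exact key _ σ rfl

/-- The behavioral strategy profiles of the `ε`-perturbed game. -/
def behavSet (A : (i : Fin 2) → I i → Type*) [∀ i J, Fintype (A i J)] (ε : ℝ) :
    Set (LocalProfile A) :=
  {x | ∀ i J, x i J ∈ perturbedSimplex (A i J) ε}

section Fin

variable [∀ i J, Fintype (A i J)]

theorem convex_perturbedSimplex (S : Type*) [Fintype S] (ε : ℝ) :
    Convex ℝ (perturbedSimplex S ε) := by
  intro x hx y hy s t hs ht hst
  refine ⟨fun a => ?_, ?_⟩
  · have h1 := mul_le_mul_of_nonneg_left (hx.1 a) hs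
    have h2 := mul_le_mul_of_nonneg_left (hy.1 a) ht
    simp only [Pi.add_apply, Pi.smul_apply, smul_eq_mul]
    calc ε = s * ε + t * ε := by rw [← add_mul, hst, one_mul]
      _ ≤ _ := add_le_add h1 h2
  · simp only [Pi.add_apply, Pi.smul_apply, smul_eq_mul, Finset.sum_add_distrib, ← Finset.mul_sum,
      hx.2, hy.2, mul_one, hst]

theorem le_one_of_mem_perturbedSimplex {S : Type*} [Fintype S] {ε : ℝ} (hε : 0 < ε) {y : S → ℝ}
    (hy : y ∈ perturbedSimplex S ε) (a : S) : y a ≤ 1 := by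
  rw [← hy.2]
  exact Finset.single_le_sum (f := y) (fun b _ => hε.le.trans (hy.1 b)) (Finset.mem_univ a)

theorem isCompact_perturbedSimplex (S : Type*) [Fintype S] {ε : ℝ} (hε : 0 < ε) :
    IsCompact (perturbedSimplex S ε) := by
  refine (isCompact_univ_pi (s := fun _ : S => Set.Icc (0 : ℝ) 1)
    fun _ => isCompact_Icc).of_isClosed_subset ?_ ?_
  · refine IsClosed.inter (s₁ := {y : S → ℝ | ∀ a, ε ≤ y a}) ?_ ?_
    · simp only [Set.ofPred_forall]
      exact isClosed_iInter fun a => isClosed_le continuous_const (continuous_apply a)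
    · exact isClosed_eq (by fun_prop) continuous_const
  · exact fun y hy a _ => ⟨hε.le.trans (hy.1 a), le_one_of_mem_perturbedSimplex hε hy a⟩

theorem convex_behavSet (ε : ℝ) : Convex ℝ (behavSet A ε) := by
  intro x hx y hy s t hs ht hst i J
  exact convex_perturbedSimplex (A i J) ε (hx i J) (hy i J) hs ht hst

theorem isCompact_behavSet {ε : ℝ} (hε : 0 < ε) : IsCompact (behavSet A ε) := by
  have : behavSet A ε = Set.univ.pi fun i => Set.univ.pi fun J => perturbedSimplex (A i J) ε := by
    ext x; simp [behavSet]
  rw [this]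
  exact isCompact_univ_pi fun i => isCompact_univ_pi fun J => isCompact_perturbedSimplex _ hε

theorem convex_polytope (G : EFG A) (ε : ℝ) (i : Fin 2) : Convex ℝ (G.polytope ε i) := by
  rintro p ⟨hp0, hp1, hp2⟩ q ⟨hq0, hq1, hq2⟩ s t hs ht hst
  refine ⟨by simp [hp0, hq0, hst], fun J => ?_, fun J a => ?_⟩
  · simp only [Pi.add_apply, Pi.smul_apply, smul_eq_mul, Finset.sum_add_distrib, ← Finset.mul_sum,
      hp1, hq1]
  · have h1 := mul_le_mul_of_nonneg_left (hp2 J a) hs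
    have h2 := mul_le_mul_of_nonneg_left (hq2 J a) ht
    simp only [Pi.add_apply, Pi.smul_apply, smul_eq_mul]
    linarith

theorem polytope_pos (G : EFG A) {ε : ℝ} (hε : 0 < ε) {i : Fin 2} {q : ActSeq A i → ℝ}
    (hq : q ∈ G.polytope ε i) (σ : ActSeq A i) : 0 < q σ := by
  induction σ using G.seq_induction i with
  | h0 => rw [hq.1]; exact one_pos
  | hs J a ih => exact (mul_pos hε ih).trans_le (hq.2.2 J a)

theorem polytope_le_parent (G : EFG A) {ε : ℝ} (hε : 0 < ε) {i : Fin 2} {q : ActSeq A i → ℝ}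
    (hq : q ∈ G.polytope ε i) (J : I i) (a : A i J) : q (some ⟨J, a⟩) ≤ q (G.parent i J) := by
  rw [← hq.2.1 J]
  exact Finset.single_le_sum (f := fun a => q (some ⟨J, a⟩))
    (fun b _ => (G.polytope_pos hε hq _).le) (Finset.mem_univ a)

theorem polytope_le_one (G : EFG A) {ε : ℝ} (hε : 0 < ε) {i : Fin 2} {q : ActSeq A i → ℝ}
    (hq : q ∈ G.polytope ε i) (σ : ActSeq A i) : q σ ≤ 1 := by
  induction σ using G.seq_induction i with
  | h0 => rw [hq.1]
  | hs J a ih => exact (G.polytope_le_parent hε hq J a).trans ih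

theorem isCompact_polytope [∀ i, Fintype (I i)] (G : EFG A) {ε : ℝ} (hε : 0 < ε) (i : Fin 2) :
    IsCompact (G.polytope ε i) := by
  refine (isCompact_univ_pi (s := fun _ : ActSeq A i => Set.Icc (0 : ℝ) 1)
    fun _ => isCompact_Icc).of_isClosed_subset ?_ ?_
  · refine IsClosed.inter (s₁ := {q : ActSeq A i → ℝ | q none = 1}) ?_ (IsClosed.inter
      (s₁ := {q : ActSeq A i → ℝ | ∀ J, ∑ a, q (some ⟨J, a⟩) = q (G.parent i J)})
      (s₂ := {q : ActSeq A i → ℝ | ∀ J a, ε * q (G.parent i J) ≤ q (some ⟨J, a⟩)}) ?_ ?_)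
    · exact isClosed_eq (by fun_prop) continuous_const
    · simp only [Set.ofPred_forall]
      exact isClosed_iInter fun J => isClosed_eq (by fun_prop) (by fun_prop)
    · simp only [Set.ofPred_forall]
      exact isClosed_iInter fun J => isClosed_iInter fun a =>
        isClosed_le (by fun_prop) (by fun_prop)
  · exact fun q hq σ _ => ⟨(G.polytope_pos hε hq σ).le, G.polytope_le_one hε hq σ⟩

theorem toSeq_pos (G : EFG A) {ε : ℝ} (hε : 0 < ε) {x : LocalProfile A} (hx : x ∈ behavSet A ε)
    (i : Fin 2) (σ : ActSeq A i) : 0 < G.toSeq x i σ := by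
  induction σ using G.seq_induction i with
  | h0 => exact one_pos
  | hs J a ih =>
    rw [toSeq_some]
    exact mul_pos ih (hε.trans_le ((hx i J).1 a))

theorem toSeq_mem (G : EFG A) {ε : ℝ} (hε : 0 < ε) {x : LocalProfile A} (hx : x ∈ behavSet A ε) :
    G.IsProfile ε (G.toSeq x) := by
  refine fun i => ⟨rfl, fun J => ?_, fun J a => ?_⟩
  · simp only [toSeq_some, ← Finset.mul_sum, (hx i J).2, mul_one]
  · rw [toSeq_some, mul_comm]
    exact mul_le_mul_of_nonneg_left ((hx i J).1 a) (G.toSeq_pos hε hx i _).le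

theorem mul_toBehav (G : EFG A) {ε : ℝ} (hε : 0 < ε) {q : SeqProfile A} (hq : G.IsProfile ε q)
    (i : Fin 2) (J : I i) (a : A i J) :
    q i (G.parent i J) * G.toBehav q i J a = q i (some ⟨J, a⟩) :=
  mul_div_cancel₀ _ (G.polytope_pos hε (hq i) _).ne'

theorem toBehav_mem (G : EFG A) {ε : ℝ} (hε : 0 < ε) {q : SeqProfile A} (hq : G.IsProfile ε q) :
    G.toBehav q ∈ behavSet A ε := by
  refine fun i J => ⟨fun a => ?_, ?_⟩
  · rw [toBehav, le_div_iff₀ (G.polytope_pos hε (hq i) _)]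
    exact (hq i).2.2 J a
  · simp only [toBehav, ← Finset.sum_div, (hq i).2.1 J]
    exact div_self (G.polytope_pos hε (hq i) _).ne'

theorem toSeq_toBehav (G : EFG A) {ε : ℝ} (hε : 0 < ε) {q : SeqProfile A}
    (hq : G.IsProfile ε q) : G.toSeq (G.toBehav q) = q := by
  funext i σ
  induction σ using G.seq_induction i with
  | h0 => exact ((hq i).1).symm
  | hs J a ih => rw [toSeq_some, ih, G.mul_toBehav hε hq]

/-- Realization probabilities in the perturbed game are bounded below, uniformly in the profile. -/
theorem exists_toSeq_lower_bound [∀ i, Fintype (I i)] (G : EFG A) {ε : ℝ} (hε : 0 < ε) :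
    ∃ m > 0, ∀ x ∈ behavSet A ε, ∀ i σ, m ≤ G.toSeq x i σ := by
  have h1 : ∀ i (σ : ActSeq A i), ∃ m > 0, ∀ x ∈ behavSet A ε, m ≤ G.toSeq x i σ := by
    intro i σ
    induction σ using G.seq_induction i with
    | h0 => exact ⟨1, one_pos, fun x _ => le_rfl⟩
    | hs J a ih =>
      obtain ⟨m, hm, h⟩ := ih
      refine ⟨m * ε, mul_pos hm hε, fun x hx => ?_⟩
      rw [toSeq_some]
      exact mul_le_mul (h x hx) ((hx i J).1 a) hε.le (hm.le.trans (h x hx))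
  choose m hm h using h1
  have : Nonempty (Σ i, ActSeq A i) := ⟨⟨0, none⟩⟩
  obtain ⟨s, hs⟩ := Finite.exists_min (fun s : Σ i, ActSeq A i => m s.1 s.2)
  exact ⟨m s.1 s.2, hm _ _, fun x hx i σ => (hs ⟨i, σ⟩).trans (h i σ x hx)⟩

section Smooth

variable [∀ i, Fintype (I i)]

theorem contDiff_apply_local (i : Fin 2) (J : I i) (a : A i J) :
    ContDiff ℝ 1 fun x : LocalProfile A => x i J a :=
  contDiff_pi.1 (contDiff_pi.1 (contDiff_pi.1 contDiff_id i) J) a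

theorem contDiff_toSeq (G : EFG A) (i : Fin 2) (σ : ActSeq A i) :
    ContDiff ℝ 1 fun x : LocalProfile A => G.toSeq x i σ := by
  induction σ using G.seq_induction i with
  | h0 => exact contDiff_const
  | hs J a ih =>
    simp only [toSeq_some]
    exact ih.mul (contDiff_apply_local i J a)

theorem contDiff_grad (G : EFG A) (i : Fin 2) (σ : ActSeq A i) :
    ContDiff ℝ 1 fun x : LocalProfile A => G.grad (G.toSeq x) i σ := by
  match i, σ with
  | 0, σ =>
    simp only [grad, mulVec, dotProduct]
    exact ContDiff.sum fun τ _ => contDiff_const.mul (G.contDiff_toSeq 1 τ)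
  | 1, σ =>
    simp only [grad, vecMul, dotProduct, Pi.neg_apply]
    exact (ContDiff.sum fun τ _ => (G.contDiff_toSeq 0 τ).mul contDiff_const).neg

theorem contDiff_cfValue (G : EFG A) (i : Fin 2) (J : I i) (a : A i J) :
    ContDiff ℝ 1 fun x : LocalProfile A => G.cfValue x i J a := by
  suffices h : ∀ σ : Σ J : I i, A i J, ContDiff ℝ 1 fun x : LocalProfile A =>
      G.backValue i (G.grad (G.toSeq x) i) (x i) σ from h ⟨J, a⟩
  intro σ
  induction σ using G.seq_backward_induction i with
  | hs σ ih =>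
    conv => enter [3, x]; rw [backValue]
    refine (G.contDiff_grad i (some σ)).add (ContDiff.sum fun J' _ => ?_)
    by_cases hp : G.parent i J' = some σ
    · simp only [hp, dif_pos]
      exact ContDiff.sum fun a' _ => (contDiff_apply_local i J' a').mul (ih J' a' hp)
    · simp only [hp, dif_neg, not_false_eq_true]
      exact contDiff_const

/-- A `C¹` function is Lipschitz on the compact convex set of perturbed behavioral profiles. -/
theorem exists_lipschitz_behavSet {ε : ℝ} (hε : 0 < ε) {f : LocalProfile A → ℝ}
    (hf : ContDiff ℝ 1 f) :
    ∃ L : ℝ, 0 ≤ L ∧ ∀ x ∈ behavSet A ε, ∀ y ∈ behavSet A ε, |f x - f y| ≤ L * ‖x - y‖ := by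
  obtain ⟨K, hK⟩ := (hf.contDiffOn (s := behavSet A ε)).exists_lipschitzOnWith one_ne_zero
    (convex_behavSet ε) (isCompact_behavSet hε)
  refine ⟨K, K.2, fun x hx y hy => ?_⟩
  have := hK.dist_le_mul x hx y hy
  rwa [Real.dist_eq, dist_eq_norm] at this

end Smooth

end Fin

end EFG

/-! ### Regret decomposition, equilibria and first order conditions -/

namespace EFG

variable {I : Fin 2 → Type*} {A : (i : Fin 2) → I i → Type*} [∀ i, Fintype (I i)]
  [∀ i J, Fintype (A i J)]

open Classical in
/-- Summation by parts along the own sequences: both sums are compared with the sum, over all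
sequences `σ`, of `p σ` times the value of the information sets immediately below `σ`. -/
theorem sum_cfValue_mul_sub (G : EFG A) (i : Fin 2) (x : LocalProfile A) (p : ActSeq A i → ℝ)
    (hp : p none = 1) :
    ∑ J, ∑ a, G.cfValue x i J a * (p (some ⟨J, a⟩) - p (G.parent i J) * x i J a)
      = ∑ σ, G.grad (G.toSeq x) i σ * (p σ - G.toSeq x i σ) := by
  set g := G.grad (G.toSeq x) i with hg
  set v := G.cfValue x i with hv
  -- the value of the information sets immediately below a sequence
  let V : ActSeq A i → ℝ := fun σ =>
    ∑ J', if G.parent i J' = σ then ∑ a', x i J' a' * v J' a' else 0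
  have hrec : ∀ J a, v J a = g (some ⟨J, a⟩) + V (some ⟨J, a⟩) := by
    intro J a
    simp only [hv, cfValue, V]
    rw [backValue]
    simp only [hg, dite_eq_ite]
  have key : ∀ p : ActSeq A i → ℝ, p none = 1 →
      ∑ J, ∑ a, v J a * (p (some ⟨J, a⟩) - p (G.parent i J) * x i J a)
        = ∑ σ : Σ J : I i, A i J, g (some σ) * p (some σ) - V none := by
    intro p hp
    have h1 : ∑ J, ∑ a, v J a * (p (G.parent i J) * x i J a) = ∑ σ, p σ * V σ := by
      simp only [V, Finset.mul_sum]
      rw [Finset.sum_comm]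
      refine Finset.sum_congr rfl fun J _ => ?_
      simp only [mul_ite, mul_zero, Finset.sum_ite_eq, Finset.mem_univ, if_true, Finset.mul_sum]
      exact Finset.sum_congr rfl fun a _ => by ring
    have h2 : ∑ J, ∑ a, v J a * p (some ⟨J, a⟩)
        = ∑ σ : Σ J : I i, A i J, g (some σ) * p (some σ)
          + ∑ σ : Σ J : I i, A i J, p (some σ) * V (some σ) := by
      rw [Fintype.sum_sigma, Fintype.sum_sigma, ← Finset.sum_add_distrib]
      refine Finset.sum_congr rfl fun J _ => ?_
      rw [← Finset.sum_add_distrib]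
      exact Finset.sum_congr rfl fun a _ => by rw [hrec]; ring
    simp only [mul_sub, Finset.sum_sub_distrib]
    rw [h1, h2, Fintype.sum_option, hp]
    ring
  have h0 := key (G.toSeq x i) rfl
  simp only [toSeq_some, sub_self, mul_zero, Finset.sum_const_zero] at h0
  rw [key p hp, Fintype.sum_option, hp, show G.toSeq x i none = 1 from rfl]
  simp only [mul_sub, Finset.sum_sub_distrib]
  linarith

/-- The regret of a sequence-form strategy splits into local regrets, weighted by the realization
probabilities of the strategy one compares with. -/
theorem sum_toSeq_mul_cfValue (G : EFG A) (i : Fin 2) (x y : LocalProfile A) :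
    ∑ J, G.toSeq y i (G.parent i J) * ∑ a, G.cfValue x i J a * (y i J a - x i J a)
      = ∑ σ, G.grad (G.toSeq x) i σ * (G.toSeq y i σ - G.toSeq x i σ) := by
  rw [← G.sum_cfValue_mul_sub i x (G.toSeq y i) rfl]
  refine Finset.sum_congr rfl fun J _ => ?_
  rw [Finset.mul_sum]
  exact Finset.sum_congr rfl fun a _ => by rw [toSeq_some]; ring

theorem sum_grad_zero (G : EFG A) (p q : SeqProfile A) :
    ∑ σ, G.grad q 0 σ * p 0 σ = p 0 ⬝ᵥ G.U *ᵥ q 1 := by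
  rw [dotProduct_comm]; rfl

theorem sum_grad_one (G : EFG A) (p q : SeqProfile A) :
    ∑ σ, G.grad q 1 σ * p 1 σ = -(q 0 ⬝ᵥ G.U *ᵥ p 1) := by
  rw [dotProduct_mulVec, ← neg_dotProduct]; rfl

/-- The game is zero-sum. -/
theorem sum_grad_mul_self (G : EFG A) (q : SeqProfile A) :
    ∑ i, ∑ σ, G.grad q i σ * q i σ = 0 := by
  rw [Fin.sum_univ_two, sum_grad_zero, sum_grad_one]
  ring

theorem sum_grad_mul_comm (G : EFG A) (p q : SeqProfile A) :
    ∑ i, ∑ σ, G.grad q i σ * p i σ = -∑ i, ∑ σ, G.grad p i σ * q i σ := by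
  simp only [Fin.sum_univ_two, sum_grad_zero, sum_grad_one]
  ring

theorem sum_grad_mul_sub_comm (G : EFG A) (p q : SeqProfile A) :
    ∑ i, ∑ σ, G.grad q i σ * (p i σ - q i σ) = -∑ i, ∑ σ, G.grad p i σ * (q i σ - p i σ) := by
  simp only [mul_sub, Finset.sum_sub_distrib, sum_grad_mul_self]
  rw [sum_grad_mul_comm]
  ring

theorem isEFPE_iff (G : EFG A) (ε : ℝ) (q : SeqProfile A) :
    G.IsEFPE ε q ↔ G.IsProfile ε q ∧
      ∀ i, ∀ p ∈ G.polytope ε i, ∑ σ, G.grad q i σ * (p σ - q i σ) ≤ 0 := by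
  have h0 : ∀ p : ActSeq A 0 → ℝ, ∑ σ, G.grad q 0 σ * (p σ - q 0 σ)
      = p ⬝ᵥ G.U *ᵥ q 1 - q 0 ⬝ᵥ G.U *ᵥ q 1 := by
    intro p
    rw [← sub_dotProduct, dotProduct_comm]; rfl
  have h1 : ∀ p : ActSeq A 1 → ℝ, ∑ σ, G.grad q 1 σ * (p σ - q 1 σ)
      = q 0 ⬝ᵥ G.U *ᵥ q 1 - q 0 ⬝ᵥ G.U *ᵥ p := by
    intro p
    rw [← neg_sub (q 0 ⬝ᵥ G.U *ᵥ p), dotProduct_mulVec, dotProduct_mulVec, ← dotProduct_sub,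
      ← neg_dotProduct]
    rfl
  rw [IsEFPE, Fin.forall_fin_two]
  simp only [h0, h1, sub_nonpos]

/-- If every local strategy is optimal against the counterfactual values, the profile is an
equilibrium. -/
theorem isEFPE_of_local (G : EFG A) {ε : ℝ} (hε : 0 < ε) {x : LocalProfile A}
    (hx : x ∈ behavSet A ε)
    (h : ∀ i J, ∀ y ∈ perturbedSimplex (A i J) ε, ∑ a, G.cfValue x i J a * (y a - x i J a) ≤ 0) :
    G.IsEFPE ε (G.toSeq x) := by
  rw [isEFPE_iff]
  refine ⟨G.toSeq_mem hε hx, fun i p hp => ?_⟩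
  rw [← G.sum_cfValue_mul_sub i x p hp.1]
  refine Finset.sum_nonpos fun J _ => ?_
  have hpos := G.polytope_pos hε hp (G.parent i J)
  have h1 := h i J (fun a => p (some ⟨J, a⟩) / p (G.parent i J)) ⟨fun a => by
    rw [le_div_iff₀ hpos]; exact hp.2.2 J a, by
    rw [← Finset.sum_div, hp.2.1 J, div_self hpos.ne']⟩
  have h2 := mul_nonpos_of_nonneg_of_nonpos hpos.le h1
  refine le_of_eq_of_le ?_ h2
  rw [Finset.mul_sum]
  refine Finset.sum_congr rfl fun a _ => ?_
  field_simp

/-- Existence of an equilibrium of the perturbed game, by the minimax theorem. -/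
theorem exists_isEFPE (G : EFG A) {ε : ℝ} (hε : 0 < ε) (hne : ∃ q, G.IsProfile ε q) :
    ∃ q, G.IsEFPE ε q := by
  obtain ⟨q₀, hq₀⟩ := hne
  have hcont1 : ∀ y : ActSeq A 0 → ℝ, Continuous fun x : ActSeq A 1 → ℝ => y ⬝ᵥ G.U *ᵥ x :=
    fun y => by simp only [dotProduct, mulVec]; fun_prop
  have hcont2 : ∀ x : ActSeq A 1 → ℝ, Continuous fun y : ActSeq A 0 → ℝ => y ⬝ᵥ G.U *ᵥ x :=
    fun x => by simp only [dotProduct]; fun_prop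
  obtain ⟨a, ha, b, hb, hab⟩ := Sion.exists_isSaddlePointOn
    (X := G.polytope ε 1) (Y := G.polytope ε 0) (f := fun x y => y ⬝ᵥ G.U *ᵥ x)
    ⟨_, hq₀ 1⟩ (G.convex_polytope ε 1) (G.isCompact_polytope hε 1)
    (fun y _ => (hcont1 y).continuousOn.lowerSemicontinuousOn)
    (fun y _ => ConvexOn.quasiconvexOn ⟨G.convex_polytope ε 1, fun x _ z _ s t _ _ _ => by
      simp [mulVec_add, mulVec_smul, dotProduct_add, dotProduct_smul]⟩)
    (G.convex_polytope ε 0) ⟨_, hq₀ 0⟩ (G.isCompact_polytope hε 0)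
    (fun x _ => (hcont2 x).continuousOn.upperSemicontinuousOn)
    (fun x _ => ConcaveOn.quasiconcaveOn ⟨G.convex_polytope ε 0, fun y _ z _ s t _ _ _ => by
      simp [add_dotProduct, smul_dotProduct]⟩)
  let q : SeqProfile A := fun i => match i with
    | 0 => b
    | 1 => a
  refine ⟨q, fun i => ?_, fun p hp => hab a ha p hp, fun p hp => hab p hp b hb⟩
  match i with
  | 0 => exact hb
  | 1 => exact ha

/-- The first order condition of the reward-transformed problem at `x`, with reference `xr`. -/
def LocalVI (G : EFG A) (ε μ : ℝ) (xr x : LocalProfile A) : Prop :=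
  ∀ i J, ∀ y ∈ perturbedSimplex (A i J) ε, ∑ a, G.rtValue μ xr x i J a * (y a - x i J a) ≤ 0

/-- A maximizer of a linear function minus a quadratic proximal term satisfies the first order
condition. -/
theorem sum_mul_sub_nonpos_of_isMaxOn {S : Type*} [Fintype S] {C : Set (S → ℝ)} (hC : Convex ℝ C)
    {μ : ℝ} (hμ : 0 ≤ μ) {v xr x : S → ℝ} (hx : x ∈ C)
    (hmax : IsMaxOn (fun y : S → ℝ => ∑ a, v a * y a - μ / 2 * ∑ a, (y a - xr a) ^ 2) C x)
    {y : S → ℝ} (hy : y ∈ C) : ∑ a, (v a + μ * (xr a - x a)) * (y a - x a) ≤ 0 := by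
  set D := ∑ a, (v a + μ * (xr a - x a)) * (y a - x a) with hD
  set B := μ / 2 * ∑ a, (y a - x a) ^ 2 with hB
  have hB0 : 0 ≤ B := mul_nonneg (by positivity) (Finset.sum_nonneg fun a _ => sq_nonneg _)
  by_contra! hpos
  -- the optimal step size, up to a factor two, is `D / B`
  obtain ⟨s, hs0, hs1, hsB⟩ : ∃ s : ℝ, 0 < s ∧ s ≤ 1 ∧ s * B < D :=
    ⟨D / (D + B), by positivity, by rw [div_le_one (by positivity)]; linarith, by
      rw [div_mul_eq_mul_div, div_lt_iff₀ (by positivity)]; nlinarith⟩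
  have hmem : x + s • (y - x) ∈ C := hC.add_smul_sub_mem hx hy ⟨hs0.le, hs1⟩
  have h := hmax hmem
  have hexp : ∑ a, v a * (x + s • (y - x)) a - μ / 2 * ∑ a, ((x + s • (y - x)) a - xr a) ^ 2
      = ∑ a, v a * x a - μ / 2 * ∑ a, (x a - xr a) ^ 2 + s * D - s ^ 2 * B := by
    simp only [hD, hB, Finset.mul_sum, ← Finset.sum_sub_distrib, ← Finset.sum_add_distrib]
    refine Finset.sum_congr rfl fun a _ => ?_
    simp only [Pi.add_apply, Pi.smul_apply, Pi.sub_apply, smul_eq_mul]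
    ring
  simp only [Set.mem_ofPred_eq, hexp] at h
  nlinarith

theorem IsRTSaddle.localVI {G : EFG A} {ε μ : ℝ} (hε : 0 < ε) (hμ : 0 < μ) {qr q : SeqProfile A}
    (h : G.IsRTSaddle ε μ qr q) : G.LocalVI ε μ (G.toBehav qr) (G.toBehav q) :=
  fun i J _ hy => sum_mul_sub_nonpos_of_isMaxOn (convex_perturbedSimplex _ ε) hμ.le
    (G.toBehav_mem hε h.1 i J) (h.2 i J) hy

end EFG

/-! ### Convergence of the saddle points across blocks -/

/-- A nonnegative sequence that decreases up to summable multiplicative and additive errors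
converges, and its decrements are summable. -/
theorem exists_tendsto_and_summable_of_descent {a e d : ℕ → ℝ} (ha : ∀ n, 0 ≤ a n)
    (he : ∀ n, 0 ≤ e n) (hd : ∀ n, 0 ≤ d n) (hs : Summable d)
    (h : ∀ n, a (n + 1) + e n ≤ (1 + d n) * a n + d n) :
    (∃ l, Tendsto a atTop (𝓝 l)) ∧ Summable e := by
  have hsum : ∀ n, ∑ k ∈ Finset.range n, d k ≤ ∑' k, d k := fun n =>
    hs.sum_le_tsum _ fun k _ => hd k
  have hexp : ∀ n, a n + 1 ≤ (a 0 + 1) * Real.exp (∑ k ∈ Finset.range n, d k) := by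
    intro n
    induction n with
    | zero => simp
    | succ n ih =>
      have h1 : 1 + d n ≤ Real.exp (d n) := by linarith [Real.add_one_le_exp (d n)]
      calc a (n + 1) + 1 ≤ (a n + 1) * (1 + d n) := by linarith [h n, he n]
        _ ≤ (a 0 + 1) * Real.exp (∑ k ∈ Finset.range n, d k) * Real.exp (d n) :=
          mul_le_mul ih h1 (by linarith [hd n]) ((add_nonneg (ha n) zero_le_one).trans ih)
        _ = _ := by rw [Finset.sum_range_succ, Real.exp_add, mul_assoc]
  set M := (a 0 + 1) * Real.exp (∑' k, d k) with hM
  have haM : ∀ n, a n + 1 ≤ M := fun n => (hexp n).trans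
    (mul_le_mul_of_nonneg_left (Real.exp_le_exp.2 (hsum n)) (by linarith [ha 0]))
  have hM0 : 0 ≤ M := by linarith [haM 0, ha 0]
  have hstep : ∀ n, a (n + 1) + e n ≤ a n + M * d n := fun n => by
    have := mul_le_mul_of_nonneg_right (haM n) (hd n)
    linarith [h n]
  constructor
  · have hanti : Antitone fun n => a n - M * ∑ k ∈ Finset.range n, d k :=
      antitone_nat_of_succ_le fun n => by
        rw [Finset.sum_range_succ]
        linarith [hstep n, he n]
    have hbdd : BddBelow (Set.range fun n => a n - M * ∑ k ∈ Finset.range n, d k) := by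
      refine ⟨-(M * ∑' k, d k), ?_⟩
      rintro _ ⟨n, rfl⟩
      have := mul_le_mul_of_nonneg_left (hsum n) hM0
      dsimp only
      linarith [ha n]
    refine ⟨_, ((tendsto_atTop_ciInf hanti hbdd).add
      (hs.hasSum.tendsto_sum_nat.const_mul M)).congr fun n => ?_⟩
    ring
  · refine summable_of_sum_range_le (c := a 0 + M * ∑' k, d k) he fun n => ?_
    have : ∑ k ∈ Finset.range n, e k ≤ a 0 - a n + M * ∑ k ∈ Finset.range n, d k := by
      induction n with
      | zero => simp
      | succ n ih =>
        rw [Finset.sum_range_succ, Finset.sum_range_succ]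
        linarith [hstep n]
    have h2 := mul_le_mul_of_nonneg_left (hsum n) hM0
    linarith [ha n]

namespace EFG

variable {I : Fin 2 → Type*} {A : (i : Fin 2) → I i → Type*} [∀ i, Fintype (I i)]
  [∀ i J, Fintype (A i J)]

/-- The squared distance of two behavioral profiles, weighted by the probabilities with which the
profile `z` realizes the parent sequences. -/
def weightedSqDist (G : EFG A) (z x y : LocalProfile A) : ℝ :=
  ∑ i, ∑ J, G.toSeq z i (G.parent i J) * ∑ a, (x i J a - y i J a) ^ 2

theorem abs_apply_sub_le_norm (x y : LocalProfile A) (i : Fin 2) (J : I i) (a : A i J) :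
    |x i J a - y i J a| ≤ ‖x - y‖ :=
  (norm_le_pi_norm ((x - y) i J) a).trans
    ((norm_le_pi_norm ((x - y) i) J).trans (norm_le_pi_norm (x - y) i))

theorem norm_sub_le_of_forall {x y : LocalProfile A} {b : ℝ} (hb : 0 ≤ b)
    (h : ∀ i J a, |x i J a - y i J a| ≤ b) : ‖x - y‖ ≤ b :=
  (pi_norm_le_iff_of_nonneg hb).2 fun i => (pi_norm_le_iff_of_nonneg hb).2 fun J =>
    (pi_norm_le_iff_of_nonneg hb).2 fun a => h i J a

theorem weightedSqDist_nonneg (G : EFG A) {ε : ℝ} (hε : 0 < ε) {z : LocalProfile A}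
    (hz : z ∈ behavSet A ε) (x y : LocalProfile A) : 0 ≤ G.weightedSqDist z x y :=
  Finset.sum_nonneg fun i _ => Finset.sum_nonneg fun _ _ =>
    mul_nonneg (G.toSeq_pos hε hz i _).le (Finset.sum_nonneg fun _ _ => sq_nonneg _)

theorem mul_sq_norm_sub_le_weightedSqDist (G : EFG A) {ε m : ℝ} (hε : 0 < ε)
    (hm : 0 < m) {z : LocalProfile A} (hz : z ∈ behavSet A ε) (hmz : ∀ i σ, m ≤ G.toSeq z i σ)
    (x y : LocalProfile A) : m * ‖x - y‖ ^ 2 ≤ G.weightedSqDist z x y := by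
  have hW := G.weightedSqDist_nonneg hε hz x y
  have h : ‖x - y‖ ≤ √(G.weightedSqDist z x y / m) := by
    refine norm_sub_le_of_forall (Real.sqrt_nonneg _) fun i J a => Real.abs_le_sqrt ?_
    rw [le_div_iff₀ hm, mul_comm]
    calc m * (x i J a - y i J a) ^ 2
        ≤ G.toSeq z i (G.parent i J) * ∑ a, (x i J a - y i J a) ^ 2 :=
          mul_le_mul (hmz _ _) (Finset.single_le_sum (f := fun a => (x i J a - y i J a) ^ 2)
            (fun _ _ => sq_nonneg _) (Finset.mem_univ a)) (sq_nonneg _)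
            (hm.le.trans (hmz _ _))
      _ ≤ ∑ J, G.toSeq z i (G.parent i J) * ∑ a, (x i J a - y i J a) ^ 2 :=
          Finset.single_le_sum
            (f := fun J => G.toSeq z i (G.parent i J) * ∑ a, (x i J a - y i J a) ^ 2)
            (fun J _ => mul_nonneg (G.toSeq_pos hε hz i _).le
              (Finset.sum_nonneg fun _ _ => sq_nonneg _)) (Finset.mem_univ J)
      _ ≤ G.weightedSqDist z x y :=
          Finset.single_le_sum (f := fun i => ∑ J, G.toSeq z i (G.parent i J) *
            ∑ a, (x i J a - y i J a) ^ 2)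
            (fun i _ => Finset.sum_nonneg fun J _ => mul_nonneg (G.toSeq_pos hε hz i _).le
              (Finset.sum_nonneg fun _ _ => sq_nonneg _)) (Finset.mem_univ i)
  have h2 := (Real.le_sqrt (norm_nonneg _) (by positivity)).1 h
  rwa [le_div_iff₀ hm, mul_comm] at h2

theorem contDiff_weightedSqDist (G : EFG A) (z y : LocalProfile A) :
    ContDiff ℝ 1 fun x => G.weightedSqDist z x y :=
  ContDiff.sum fun i _ => ContDiff.sum fun J _ => contDiff_const.mul <| ContDiff.sum fun a _ =>
    ((contDiff_apply_local i J a).sub contDiff_const).pow 2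

theorem abs_sub_le_profileDist (p q : SeqProfile A) (i : Fin 2) (σ : ActSeq A i) :
    |p i σ - q i σ| ≤ profileDist p q := by
  refine Real.abs_le_sqrt ?_
  calc (p i σ - q i σ) ^ 2 ≤ ∑ σ, (p i σ - q i σ) ^ 2 :=
        Finset.single_le_sum (f := fun σ => (p i σ - q i σ) ^ 2) (fun _ _ => sq_nonneg _)
          (Finset.mem_univ σ)
    _ ≤ _ := Finset.single_le_sum (f := fun i => ∑ σ, (p i σ - q i σ) ^ 2)
          (fun _ _ => Finset.sum_nonneg fun _ _ => sq_nonneg _) (Finset.mem_univ i)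

/-- Behavioral forms depend Lipschitz continuously on the profile in the perturbed game, where all
realization probabilities are bounded away from zero. -/
theorem exists_lipschitz_toBehav (G : EFG A) {ε : ℝ} (hε : 0 < ε) :
    ∃ C : ℝ, 0 ≤ C ∧ ∀ p q, G.IsProfile ε p → G.IsProfile ε q →
      ‖G.toBehav p - G.toBehav q‖ ≤ C * profileDist p q := by
  obtain ⟨m, hm, hlow⟩ := G.exists_toSeq_lower_bound hε
  have hD : ∀ p q : SeqProfile A, 0 ≤ profileDist p q := fun p q => Real.sqrt_nonneg _
  refine ⟨2 / m, by positivity, fun p q hp hq => norm_sub_le_of_forall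
    (mul_nonneg (by positivity) (hD p q)) fun i J a => ?_⟩
  have hpm := hlow _ (G.toBehav_mem hε hp) i (G.parent i J)
  rw [G.toSeq_toBehav hε hp] at hpm
  have hppos : 0 < p i (G.parent i J) := G.polytope_pos hε (hp i) _
  have hqb := G.toBehav_mem hε hq i J
  have hq1 : |G.toBehav q i J a| ≤ 1 := abs_le.2
    ⟨by linarith [hqb.1 a], le_one_of_mem_perturbedSimplex hε hqb a⟩
  have hpe := G.mul_toBehav hε hp i J a
  have hqe := G.mul_toBehav hε hq i J a
  have heq : p i (G.parent i J) * (G.toBehav p i J a - G.toBehav q i J a)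
      = (p i (some ⟨J, a⟩) - q i (some ⟨J, a⟩))
        - (p i (G.parent i J) - q i (G.parent i J)) * G.toBehav q i J a := by
    linear_combination hpe - hqe
  have h1 := abs_sub_le_profileDist p q i (some ⟨J, a⟩)
  have h2 := abs_sub_le_profileDist p q i (G.parent i J)
  have h3 : p i (G.parent i J) * |G.toBehav p i J a - G.toBehav q i J a|
      ≤ 2 * profileDist p q := by
    rw [← abs_of_pos hppos, ← abs_mul, heq]
    refine (abs_sub _ _).trans ?_
    rw [abs_mul, two_mul]
    refine add_le_add h1 ((mul_le_mul h2 hq1 (abs_nonneg _) (hD p q)).trans_eq (mul_one _))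
  rw [div_mul_eq_mul_div, le_div_iff₀ hm, mul_comm]
  exact (mul_le_mul_of_nonneg_right hpm (abs_nonneg _)).trans h3

/-- The proximal step brings the profile closer to every equilibrium `z`, in the distance weighted
by the realization probabilities of `z`. -/
theorem LocalVI.weightedSqDist_add_le {G : EFG A} {ε μ : ℝ} (hε : 0 < ε) (hμ : 0 < μ)
    {xr x z : LocalProfile A} (hx : x ∈ behavSet A ε) (hz : z ∈ behavSet A ε)
    (hvi : G.LocalVI ε μ xr x) (hE : G.IsEFPE ε (G.toSeq z)) :
    G.weightedSqDist z x z + G.weightedSqDist z x xr ≤ G.weightedSqDist z xr z := by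
  have h0 : 0 ≤ ∑ i, ∑ J, G.toSeq z i (G.parent i J) *
      ∑ a, G.cfValue x i J a * (z i J a - x i J a) := by
    simp only [sum_toSeq_mul_cfValue]
    rw [sum_grad_mul_sub_comm, neg_nonneg]
    exact Finset.sum_nonpos fun i _ =>
      ((G.isEFPE_iff ε _).1 hE).2 i _ (G.toSeq_mem hε hx i)
  have h1 : ∑ i, ∑ J, G.toSeq z i (G.parent i J) *
      ∑ a, G.cfValue x i J a * (z i J a - x i J a)
      ≤ ∑ i, ∑ J, G.toSeq z i (G.parent i J) * (μ / 2 * (∑ a, (xr i J a - z i J a) ^ 2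
        - ∑ a, (x i J a - z i J a) ^ 2 - ∑ a, (x i J a - xr i J a) ^ 2)) := by
    refine Finset.sum_le_sum fun i _ => Finset.sum_le_sum fun J _ =>
      mul_le_mul_of_nonneg_left ?_ (G.toSeq_pos hε hz i _).le
    rw [← sub_nonpos]
    refine le_of_eq_of_le ?_ (hvi i J (z i J) (hz i J))
    simp only [← Finset.sum_sub_distrib, Finset.mul_sum, rtValue]
    exact Finset.sum_congr rfl fun a _ => by ring
  have h2 : ∑ i, ∑ J, G.toSeq z i (G.parent i J) * (μ / 2 * (∑ a, (xr i J a - z i J a) ^ 2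
        - ∑ a, (x i J a - z i J a) ^ 2 - ∑ a, (x i J a - xr i J a) ^ 2))
      = μ / 2 * (G.weightedSqDist z xr z - G.weightedSqDist z x z - G.weightedSqDist z x xr) := by
    simp only [weightedSqDist, mul_sub, Finset.sum_sub_distrib, Finset.mul_sum]
    simp only [mul_left_comm]
  rw [h2] at h1
  have h3 := nonneg_of_mul_nonneg_right (h0.trans h1) (by positivity)
  linarith

/-- Convergence of the proximal point iteration with summable reset errors. -/
theorem exists_tendsto_of_localVI (G : EFG A) {ε μ : ℝ} (hε : 0 < ε) (hμ : 0 < μ)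
    {xr x : ℕ → LocalProfile A} (hxr : ∀ n, xr n ∈ behavSet A ε) (hx : ∀ n, x n ∈ behavSet A ε)
    (hvi : ∀ n, G.LocalVI ε μ (xr n) (x n)) {δ : ℕ → ℝ} (hδ : Summable δ)
    (hreset : ∀ n, ‖xr (n + 1) - x n‖ ≤ δ n) :
    ∃ z ∈ behavSet A ε, G.IsEFPE ε (G.toSeq z) ∧ Tendsto x atTop (𝓝 z) ∧
      Tendsto (fun n => xr n - x n) atTop (𝓝 0) := by
  obtain ⟨m, hm, hlow⟩ := G.exists_toSeq_lower_bound hε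
  have hstep : ∀ z ∈ behavSet A ε, G.IsEFPE ε (G.toSeq z) →
      (∃ l, Tendsto (fun n => G.weightedSqDist z (x n) z) atTop (𝓝 l)) ∧
      Summable fun n => G.weightedSqDist z (x (n + 1)) (xr (n + 1)) := by
    intro z hz hE
    obtain ⟨C, hC0, hC⟩ := exists_lipschitz_behavSet hε (G.contDiff_weightedSqDist z z)
    have hδ0 : ∀ n, 0 ≤ δ n := fun n => (norm_nonneg _).trans (hreset n)
    refine exists_tendsto_and_summable_of_descent (d := fun n => C * δ n)
      (fun n => G.weightedSqDist_nonneg hε hz _ _) (fun n => G.weightedSqDist_nonneg hε hz _ _)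
      (fun n => mul_nonneg hC0 (hδ0 n)) (hδ.mul_left C) fun n => ?_
    have h1 := (hvi (n + 1)).weightedSqDist_add_le hε hμ (hx _) hz hE
    have h2 := (abs_le.1 (hC _ (hxr (n + 1)) _ (hx n))).2
    have h3 := mul_le_mul_of_nonneg_left (hreset n) hC0
    have h4 := mul_nonneg (mul_nonneg hC0 (hδ0 n)) (G.weightedSqDist_nonneg hε hz (x n) z)
    linarith
  have hsq : ∀ z ∈ behavSet A ε, ∀ u v : ℕ → LocalProfile A,
      Tendsto (fun n => G.weightedSqDist z (u n) (v n)) atTop (𝓝 0) →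
      Tendsto (fun n => u n - v n) atTop (𝓝 0) := by
    intro z hz u v h
    have h1 : Tendsto (fun n => ‖u n - v n‖ ^ 2) atTop (𝓝 0) :=
      squeeze_zero (g := fun n => G.weightedSqDist z (u n) (v n) / m) (fun n => sq_nonneg _)
        (fun n => by
        rw [le_div_iff₀ hm, mul_comm]
        exact G.mul_sq_norm_sub_le_weightedSqDist hε hm hz (hlow z hz) (u n) (v n))
        (by simpa using h.div_const m)
    rw [tendsto_zero_iff_norm_tendsto_zero]
    simpa [Real.sqrt_sq (norm_nonneg _)] using h1.sqrt
  have hdiff : Tendsto (fun n => xr n - x n) atTop (𝓝 0) := by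
    obtain ⟨q, hq⟩ := G.exists_isEFPE hε ⟨_, G.toSeq_mem hε (hx 0)⟩
    have hz := G.toBehav_mem hε hq.1
    rw [← G.toSeq_toBehav hε hq.1] at hq
    have h1 := hsq _ hz _ _ (hstep _ hz hq).2.tendsto_atTop_zero
    rw [← tendsto_add_atTop_iff_nat 1]
    simpa using h1.neg
  obtain ⟨z, hz, φ, hφ, hlim⟩ := (isCompact_behavSet hε).tendsto_subseq hx
  have hE : G.IsEFPE ε (G.toSeq z) := by
    refine G.isEFPE_of_local hε hz fun i J y hy => ?_
    have hxa : ∀ a, Tendsto (fun n => x (φ n) i J a) atTop (𝓝 (z i J a)) := fun a =>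
      ((contDiff_apply_local i J a).continuous.tendsto z).comp hlim
    have hda : ∀ a, Tendsto (fun n => xr (φ n) i J a - x (φ n) i J a) atTop (𝓝 0) := fun a =>
      ((contDiff_apply_local i J a).continuous.tendsto 0).comp (hdiff.comp hφ.tendsto_atTop)
    have hva : ∀ a, Tendsto (fun n => G.rtValue μ (xr (φ n)) (x (φ n)) i J a) atTop
        (𝓝 (G.cfValue z i J a)) := fun a => by
      simpa [rtValue] using (((G.contDiff_cfValue i J a).continuous.tendsto z).comp hlim).add
        ((hda a).const_mul μ)
    refine le_of_tendsto' (tendsto_finsetSum Finset.univ fun a _ =>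
      (hva a).mul ((hxa a).const_sub (y a))) fun n => hvi (φ n) i J y hy
  refine ⟨z, hz, hE, ?_, hdiff⟩
  obtain ⟨l, hl⟩ := (hstep z hz hE).1
  have h0 : Tendsto (fun n => G.weightedSqDist z (x (φ n)) z) atTop (𝓝 0) := by
    have := ((G.contDiff_weightedSqDist z z).continuous.tendsto z).comp hlim
    simpa [weightedSqDist, Function.comp_def] using this
  rw [tendsto_nhds_unique (hl.comp hφ.tendsto_atTop) h0] at hl
  have h1 := hsq z hz x (fun _ => z) hl
  simpa using h1.add_const z

end EFG

/-! ### Regret matching within a block -/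

/-- What the three regret rules have in common: the positive parts do not exceed those of the plain
update, and the regrets fall behind the plain update only by a summable fraction of the positive
part. -/
theorem RegretRule.Admissible.exists_discount {rule : RegretRule} (h : rule.Admissible) :
    ∃ d : ℕ → ℝ, (∀ t, 0 ≤ d t) ∧ Summable d ∧ ∀ t Y,
      Y - d t * max Y 0 ≤ rule.update (t + 1) Y ∧ max (rule.update (t + 1) Y) 0 ≤ max Y 0 := by
  cases rule with
  | rm => exact ⟨fun _ => 0, fun _ => le_rfl, summable_zero, fun t Y => by simp [update]⟩
  | rmPlus =>
    refine ⟨fun _ => 0, fun _ => le_rfl, summable_zero, fun t Y => ?_⟩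
    simp [update]
  | discounted α β =>
    have hpow : ∀ (t : ℕ) (γ : ℝ), 0 < ((t + 1 : ℕ) : ℝ) ^ γ := fun t γ => by positivity
    refine ⟨fun t => 1 / (((t + 1 : ℕ) : ℝ) ^ α + 1), fun t => ?_, ?_, fun t Y => ?_⟩
    · have := hpow t α
      positivity
    · have h1 : Summable fun t : ℕ => 1 / ((t + 1 : ℕ) : ℝ) ^ α :=
        (summable_nat_add_iff 1).2 (Real.summable_one_div_nat_rpow.2 h)
      refine Summable.of_nonneg_of_le (fun t => ?_) (fun t => ?_) h1
      · have := hpow t α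
        positivity
      · exact one_div_le_one_div_of_le (hpow t α) (by linarith)
    · have ha := hpow t α
      have hb := hpow t β
      simp only [update]
      set a := ((t + 1 : ℕ) : ℝ) ^ α
      set b := ((t + 1 : ℕ) : ℝ) ^ β
      have ha1 : 1 / (a + 1) = 1 - a / (a + 1) := by field_simp; ring
      have ha2 : a / (a + 1) ≤ 1 := by rw [div_le_one (by positivity)]; linarith
      have hb2 : b / (b + 1) ≤ 1 := by rw [div_le_one (by positivity)]; linarith
      have hb3 : 0 ≤ b / (b + 1) := by positivity
      rw [ha1]
      rcases le_total 0 Y with hY | hY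
      · simp only [max_eq_left hY, min_eq_right hY, mul_zero, add_zero]
        exact ⟨by linarith, max_le (by nlinarith) hY⟩
      · simp only [max_eq_right hY, min_eq_left hY, mul_zero, zero_add, sub_zero]
        exact ⟨by nlinarith, max_le (by nlinarith) le_rfl⟩

theorem sq_le_of_le_max {P P' r : ℝ} (hP' : 0 ≤ P') (h : P' ≤ max (P + r) 0) :
    P' ^ 2 ≤ P ^ 2 + 2 * P * r + r ^ 2 := by
  rcases le_total 0 (P + r) with h1 | h1
  · rw [max_eq_left h1] at h
    nlinarith
  · rw [max_eq_right h1] at h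
    nlinarith [sq_nonneg (P + r)]

/-- Where the limiting regret `rs` is negative, a linear term in the potential absorbs the square of
the regret `r` as long as `r ≤ 0`; and if `r > 0`, then `r` is at distance at least `|rs|` from
`rs`. -/
theorem sq_add_le_of_neg {P P' r rs M u : ℝ} (hP : 0 ≤ P) (hP' : 0 ≤ P')
    (h : P' ≤ max (P + r) 0) (hrs : rs < 0) (hM : |r| ≤ M) (hu : |r - rs| ≤ u) :
    P' ^ 2 + 2 * M * P' ≤ P ^ 2 + 2 * M * P + 2 * P * r + (u ^ 2 + 2 * M * (u ^ 2 / -rs)) := by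
  have hM0 : 0 ≤ M := (abs_nonneg r).trans hM
  have hE : 0 ≤ u ^ 2 / -rs := div_nonneg (sq_nonneg u) (by linarith)
  have hME := mul_nonneg hM0 hE
  rcases le_total r 0 with hr | hr
  · rw [abs_of_nonpos hr] at hM
    rcases le_total 0 (P + r) with h1 | h1
    · rw [max_eq_left h1] at h
      nlinarith [sq_nonneg u]
    · rw [max_eq_right h1] at h
      have : P' = 0 := le_antisymm h hP'
      subst this
      nlinarith [sq_nonneg u]
  · rw [abs_of_nonneg hr] at hM
    rw [max_eq_left (by linarith)] at h
    rw [abs_of_nonneg (by linarith)] at hu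
    have h1 : r ≤ u ^ 2 / -rs := by
      rw [le_div_iff₀ (by linarith)]
      nlinarith
    have h2 := mul_le_mul_of_nonneg_left h1 hM0
    have h3 := mul_le_mul_of_nonneg_left h hM0
    nlinarith

/-- The Lyapunov argument for regret matching. The vector `r t` of instantaneous regrets is
orthogonal to the positive part of the cumulative regrets `R t` (regret matching), has a gain at
least `c s²` in the direction `xh` of the solution, and is `O(s)`-close to the regrets `rs ≤ 0` of
the solution, which vanish on the support of `xh`; here `s t` is the distance of the iterate to the
solution. The potential of the coordinate `j` is `P² + κ P - 2 λ xh R` with `P` the positive part of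
`R`, where `κ > 0` only if `rs j < 0`. -/
theorem summable_sq_of_regret_dynamics {ι : Type*} [Fintype ι] {w xh rs L M : ι → ℝ}
    {R r : ℕ → ι → ℝ} {s d : ℕ → ℝ} {c : ℝ} (hw : ∀ j, 0 ≤ w j) (hxh0 : ∀ j, 0 ≤ xh j)
    (hxh1 : ∀ j, xh j ≤ 1) (hrs : ∀ j, rs j ≤ 0) (hcompl : ∀ j, xh j * rs j = 0)
    (hM : ∀ t j, |r t j| ≤ M j) (hL : ∀ t j, |r t j - rs j| ≤ L j * s t)
    (hd : ∀ t, 0 ≤ d t) (hds : Summable d)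
    (hlow : ∀ t j, R t j + r t j - d t * max (R t j + r t j) 0 ≤ R (t + 1) j)
    (hup : ∀ t j, max (R (t + 1) j) 0 ≤ max (R t j + r t j) 0)
    (horth : ∀ t, ∑ j, w j * (max (R t j) 0 * r t j) = 0) (hc : 0 < c)
    (hgain : ∀ t, c * s t ^ 2 ≤ ∑ j, w j * (xh j * r t j)) :
    Summable fun t => s t ^ 2 := by
  have hM0 : ∀ j, 0 ≤ M j := fun j => (abs_nonneg _).trans (hM 0 j)
  let κ : ι → ℝ := fun j => if rs j < 0 then 2 * M j else 0
  let C : ι → ℝ := fun j => L j ^ 2 + κ j * (L j ^ 2 / -rs j)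
  have hκ0 : ∀ j, 0 ≤ κ j := fun j => by
    simp only [κ]; split_ifs
    · exact mul_nonneg zero_le_two (hM0 j)
    · exact le_rfl
  have hC0 : ∀ j, 0 ≤ C j := fun j => add_nonneg (sq_nonneg _)
    (mul_nonneg (hκ0 j) (div_nonneg (sq_nonneg _) (neg_nonneg.2 (hrs j))))
  set CC := ∑ j, w j * C j with hCC
  have hCC0 : 0 ≤ CC := Finset.sum_nonneg fun j _ => mul_nonneg (hw j) (hC0 j)
  -- `l` is so large that the gain outweighs the quadratic errors
  set l := (CC + 1) / (2 * c) with hl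
  have hl0 : 0 < l := by positivity
  have hlc : 2 * l * c = CC + 1 := by rw [hl]; field_simp
  let f : ι → ℝ → ℝ := fun j x => max x 0 ^ 2 + κ j * max x 0 - 2 * l * xh j * x
  have hf : ∀ j x, max x 0 ^ 2 / 2 - 2 * l ^ 2 ≤ f j x := by
    intro j x
    have h1 : xh j * x ≤ max x 0 := calc
      xh j * x ≤ xh j * max x 0 := mul_le_mul_of_nonneg_left (le_max_left _ _) (hxh0 j)
      _ ≤ 1 * max x 0 := mul_le_mul_of_nonneg_right (hxh1 j) (le_max_right _ _)
      _ = _ := one_mul _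
    have h2 := mul_nonneg (hκ0 j) (le_max_right x 0)
    have h3 := mul_le_mul_of_nonneg_left h1 hl0.le
    simp only [f]
    nlinarith [sq_nonneg (max x 0 - 2 * l)]
  have hstep : ∀ t j, f j (R (t + 1) j) ≤ f j (R t j) + 2 * (max (R t j) 0 * r t j)
      - 2 * l * (xh j * r t j) + C j * s t ^ 2
      + 2 * l * d t * (xh j * max (R t j + r t j) 0) := by
    intro t j
    have hP' : max (R (t + 1) j) 0 ≤ max (max (R t j) 0 + r t j) 0 :=
      (hup t j).trans (max_le_max (by linarith [le_max_left (R t j) 0]) le_rfl)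
    have hlin := mul_le_mul_of_nonneg_left (mul_le_mul_of_nonneg_left (hlow t j) (hxh0 j)) hl0.le
    rcases (hrs j).lt_or_eq with hneg | hzero
    · have h0 : xh j = 0 := (mul_eq_zero.1 (hcompl j)).resolve_right hneg.ne
      have h1 := sq_add_le_of_neg (le_max_right (R t j) 0) (le_max_right (R (t + 1) j) 0) hP' hneg
        (hM t j) (hL t j)
      simp only [f, C, κ, if_pos hneg, h0]
      have h2 : (L j * s t) ^ 2 / -rs j = L j ^ 2 / -rs j * s t ^ 2 := by ring
      rw [h2] at h1
      linarith
    · have h1 := sq_le_of_le_max (le_max_right (R (t + 1) j) 0) hP'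
      have h2 : r t j ^ 2 ≤ (L j * s t) ^ 2 := by
        have := hL t j
        rw [hzero, sub_zero] at this
        exact sq_le_sq' (abs_le.1 this).1 (abs_le.1 this).2
      simp only [f, C, κ, hzero, lt_irrefl, if_false]
      linarith
  set K := ∑ j, w j * (2 * l ^ 2 + 1 / 2 + M j) with hK
  have hΨ : ∀ t, ∑ j, w j * (xh j * max (R t j + r t j) 0) ≤ ∑ j, w j * f j (R t j) + K := by
    intro t
    rw [hK, ← Finset.sum_add_distrib]
    refine Finset.sum_le_sum fun j _ => ?_
    rw [← mul_add]
    refine mul_le_mul_of_nonneg_left ?_ (hw j)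
    have h1 : max (R t j + r t j) 0 ≤ max (R t j) 0 + M j :=
      max_le (add_le_add (le_max_left _ _) (abs_le.1 (hM t j)).2)
        (add_nonneg (le_max_right _ _) (hM0 j))
    have h2 : xh j * max (R t j + r t j) 0 ≤ 1 * max (R t j + r t j) 0 :=
      mul_le_mul_of_nonneg_right (hxh1 j) (le_max_right _ _)
    nlinarith [hf j (R t j), sq_nonneg (max (R t j) 0 - 1)]
  have hΨ0 : ∀ t, 0 ≤ ∑ j, w j * f j (R t j) + K := fun t => le_trans
    (Finset.sum_nonneg fun j _ => mul_nonneg (hw j)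
      (mul_nonneg (hxh0 j) (le_max_right _ _))) (hΨ t)
  refine (exists_tendsto_and_summable_of_descent (a := fun t => ∑ j, w j * f j (R t j) + K)
    (d := fun t => 2 * l * d t) hΨ0 (fun t => sq_nonneg _)
    (fun t => mul_nonneg (by positivity) (hd t)) (hds.mul_left _) fun t => ?_).2
  have h1 : ∑ j, w j * f j (R (t + 1) j) ≤ ∑ j, w j * f j (R t j)
      + 2 * ∑ j, w j * (max (R t j) 0 * r t j) - 2 * l * ∑ j, w j * (xh j * r t j)
      + CC * s t ^ 2 + 2 * l * d t * ∑ j, w j * (xh j * max (R t j + r t j) 0) := by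
    rw [hCC]
    simp only [Finset.mul_sum, Finset.sum_mul, ← Finset.sum_add_distrib, ← Finset.sum_sub_distrib]
    refine Finset.sum_le_sum fun j _ => ?_
    refine (mul_le_mul_of_nonneg_left (hstep t j) (hw j)).trans_eq ?_
    ring
  rw [horth t] at h1
  have hld : 0 ≤ 2 * l * d t := mul_nonneg (by positivity) (hd t)
  have h2 := mul_le_mul_of_nonneg_left (hgain t) (show 0 ≤ 2 * l by positivity)
  have h3 := mul_le_mul_of_nonneg_left (hΨ t) hld
  rw [← mul_assoc, hlc] at h2
  linarith

theorem regretMatching_nonneg {S : Type*} [Fintype S] (R : S → ℝ) (a : S) :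
    0 ≤ regretMatching R a := by
  unfold regretMatching
  split_ifs with h
  · exact div_nonneg (le_max_right _ _) h.le
  · positivity

theorem sum_regretMatching {S : Type*} [Fintype S] [Nonempty S] (R : S → ℝ) :
    ∑ a, regretMatching R a = 1 := by
  unfold regretMatching
  split_ifs with h
  · rw [← Finset.sum_div, div_self h.ne']
  · simp

theorem max_eq_mul_regretMatching {S : Type*} [Fintype S] (R : S → ℝ) (a : S) :
    max (R a) 0 = (∑ b, max (R b) 0) * regretMatching R a := by
  unfold regretMatching
  split_ifs with h
  · exact (mul_div_cancel₀ _ h.ne').symm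
  · have h0 : ∑ b, max (R b) 0 = 0 :=
      le_antisymm (not_lt.1 h) (Finset.sum_nonneg fun b _ => le_max_right _ _)
    rw [h0, zero_mul]
    exact (Finset.sum_eq_zero_iff_of_nonneg fun b _ => le_max_right (R b) 0).1 h0 a
      (Finset.mem_univ a)

theorem basisMatrix_mulVec {S : Type*} [Fintype S] (ε : ℝ) {y : S → ℝ} (hy : ∑ a, y a = 1)
    (a : S) : (basisMatrix S ε *ᵥ y) a = ε + (1 - (Fintype.card S : ℝ) * ε) * y a := by
  classical
  simp [basisMatrix, mulVec, dotProduct, add_mul, Finset.sum_add_distrib, ← Finset.mul_sum, hy]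

theorem basisMatrix_mulVec_mem {S : Type*} [Fintype S] {ε : ℝ}
    (hcard : (Fintype.card S : ℝ) * ε ≤ 1) {y : S → ℝ} (hy0 : ∀ a, 0 ≤ y a)
    (hy : ∑ a, y a = 1) : basisMatrix S ε *ᵥ y ∈ perturbedSimplex S ε := by
  refine ⟨fun a => ?_, ?_⟩
  · rw [basisMatrix_mulVec ε hy]
    linarith [mul_nonneg (sub_nonneg.2 hcard) (hy0 a)]
  · simp only [basisMatrix_mulVec ε hy, Finset.sum_add_distrib, ← Finset.mul_sum, hy]
    simp

theorem basisMatrix_col_mem {S : Type*} [Fintype S] {ε : ℝ}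
    (hcard : (Fintype.card S : ℝ) * ε ≤ 1) (j : S) :
    (fun a => basisMatrix S ε a j) ∈ perturbedSimplex S ε := by
  classical
  have h := basisMatrix_mulVec_mem hcard (y := Pi.single j 1)
    (fun a => by by_cases h : a = j <;> simp [h]) (by simp)
  rwa [mulVec_single_one] at h

/-- The basis matrix maps the simplex onto the perturbed simplex. -/
theorem exists_basisMatrix_mulVec_eq {S : Type*} [Fintype S] [Nonempty S] {ε : ℝ}
    (hcard : (Fintype.card S : ℝ) * ε ≤ 1) {x : S → ℝ} (hx : x ∈ perturbedSimplex S ε) :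
    ∃ y : S → ℝ, (∀ a, 0 ≤ y a) ∧ ∑ a, y a = 1 ∧ basisMatrix S ε *ᵥ y = x := by
  have hsum : ∑ a, (x a - ε) = 1 - (Fintype.card S : ℝ) * ε := by
    rw [Finset.sum_sub_distrib, hx.2]; simp
  rcases hcard.lt_or_eq with hlt | heq
  · have hτ : 0 < 1 - (Fintype.card S : ℝ) * ε := sub_pos.2 hlt
    have hs1 : ∑ a, (x a - ε) / (1 - (Fintype.card S : ℝ) * ε) = 1 := by
      rw [← Finset.sum_div, hsum, div_self hτ.ne']
    refine ⟨fun a => (x a - ε) / (1 - (Fintype.card S : ℝ) * ε),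
      fun a => div_nonneg (sub_nonneg.2 (hx.1 a)) hτ.le, hs1, ?_⟩
    funext a
    rw [basisMatrix_mulVec ε hs1, mul_div_cancel₀ _ hτ.ne']
    ring
  · -- the perturbed simplex is a single point
    have hs1 : ∑ _a : S, 1 / (Fintype.card S : ℝ) = 1 := by simp
    refine ⟨fun _ => 1 / (Fintype.card S : ℝ), fun a => by positivity, hs1, ?_⟩
    funext a
    rw [heq, sub_self] at hsum
    have := (Finset.sum_eq_zero_iff_of_nonneg fun a _ => sub_nonneg.2 (hx.1 a)).1 hsum a
      (Finset.mem_univ a)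
    rw [basisMatrix_mulVec ε hs1, heq]
    linarith

namespace EFG

variable {I : Fin 2 → Type*} {A : (i : Fin 2) → I i → Type*} [∀ i J, Fintype (A i J)]

theorem play_mem [∀ i J, Nonempty (A i J)] {ε : ℝ}
    (hcard : ∀ i J, (Fintype.card (A i J) : ℝ) * ε ≤ 1) (R : LocalProfile A) :
    play ε R ∈ behavSet A ε :=
  fun i J => basisMatrix_mulVec_mem (hcard i J) (regretMatching_nonneg _) (sum_regretMatching _)

variable [∀ i, Fintype (I i)]

/-- The regrets of the profile `x` for the vertices of the perturbed simplices, with respect to the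
reward-transformed counterfactual values. -/
noncomputable def vertexRegret (G : EFG A) (ε μ : ℝ) (xr x : LocalProfile A) : LocalProfile A :=
  fun i J j => ∑ a, G.rtValue μ xr x i J a * (basisMatrix (A i J) ε a j - x i J a)

theorem instRegret_eq_vertexRegret (G : EFG A) (ε μ : ℝ) (xr R : LocalProfile A) :
    G.instRegret ε μ xr R = G.vertexRegret ε μ xr (play ε R) := by
  funext i J j
  simp only [instRegret, vertexRegret, mul_sub, Finset.sum_sub_distrib]
  rw [mulVec_transpose, ← dotProduct_mulVec]
  rfl

theorem contDiff_vertexRegret (G : EFG A) (ε μ : ℝ) (xr : LocalProfile A) (i : Fin 2) (J : I i)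
    (j : A i J) : ContDiff ℝ 1 fun x => G.vertexRegret ε μ xr x i J j := by
  refine ContDiff.sum fun a _ => ContDiff.mul ?_ (contDiff_const.sub (contDiff_apply_local i J a))
  exact (G.contDiff_cfValue i J a).add
    (contDiff_const.mul (contDiff_const.sub (contDiff_apply_local i J a)))

theorem sum_mul_vertexRegret (G : EFG A) (ε μ : ℝ) (xr x : LocalProfile A) (i : Fin 2) (J : I i)
    {y : A i J → ℝ} (hy : ∑ a, y a = 1) :
    ∑ j, y j * G.vertexRegret ε μ xr x i J j
      = ∑ a, G.rtValue μ xr x i J a * ((basisMatrix (A i J) ε *ᵥ y) a - x i J a) := by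
  simp only [vertexRegret, Finset.mul_sum]
  rw [Finset.sum_comm]
  refine Finset.sum_congr rfl fun a _ => ?_
  calc ∑ j, y j * (G.rtValue μ xr x i J a * (basisMatrix (A i J) ε a j - x i J a))
      = G.rtValue μ xr x i J a * (∑ j, basisMatrix (A i J) ε a j * y j - x i J a * ∑ j, y j) := by
        rw [Finset.mul_sum, ← Finset.sum_sub_distrib, Finset.mul_sum]
        exact Finset.sum_congr rfl fun j _ => by ring
    _ = _ := by rw [hy, mul_one]; rfl

/-- Regret matching plays proportionally to the positive regrets, hence has zero regret on
average. -/
theorem sum_max_mul_vertexRegret [∀ i J, Nonempty (A i J)] (G : EFG A) (ε μ : ℝ)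
    (xr R : LocalProfile A) (i : Fin 2) (J : I i) :
    ∑ j, max (R i J j) 0 * G.vertexRegret ε μ xr (play ε R) i J j = 0 := by
  have h : ∀ j, max (R i J j) 0 * G.vertexRegret ε μ xr (play ε R) i J j
      = (∑ b, max (R i J b) 0) *
        (regretMatching (R i J) j * G.vertexRegret ε μ xr (play ε R) i J j) := fun j => by
    rw [max_eq_mul_regretMatching (R i J) j, mul_assoc]
  simp only [h]
  rw [← Finset.mul_sum, sum_mul_vertexRegret _ _ _ _ _ _ _ (sum_regretMatching _)]
  simp [play]

/-- Strong monotonicity at a solution `z` whose reference is close to it. The realization weights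
`z` and `x` of the two first order conditions differ by `O(‖x - z‖)`, which is harmless only because
it is multiplied by the small distance of `z` to the reference. -/
theorem exists_strong_localVI (G : EFG A) {ε μ : ℝ} (hε : 0 < ε) (hμ : 0 < μ) :
    ∃ ρ > 0, ∃ c > 0, ∀ xr z x : LocalProfile A, z ∈ behavSet A ε → x ∈ behavSet A ε →
      G.LocalVI ε μ xr z → ‖xr - z‖ ≤ ρ →
      c * ‖x - z‖ ^ 2 ≤ ∑ i, ∑ J, G.toSeq z i (G.parent i J) *
        ∑ a, G.rtValue μ xr x i J a * (z i J a - x i J a) := by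
  obtain ⟨m, hm, hlow⟩ := G.exists_toSeq_lower_bound hε
  choose L hL0 hL using fun i (σ : ActSeq A i) =>
    exists_lipschitz_behavSet hε (G.contDiff_toSeq i σ)
  set N := ∑ i, ∑ J, L i (G.parent i J) * (Fintype.card (A i J) : ℝ) with hN
  have hN0 : 0 ≤ N := Finset.sum_nonneg fun i _ => Finset.sum_nonneg fun J _ =>
    mul_nonneg (hL0 _ _) (by positivity)
  refine ⟨m / (2 * (N + 1)), by positivity, μ * (m / 2), by positivity,
    fun xr z x hz hx hvi hρ => ?_⟩
  set s := ‖x - z‖ with hs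
  have hs0 : 0 ≤ s := norm_nonneg _
  have hswap : ∑ i, ∑ J, G.toSeq z i (G.parent i J) *
        ∑ a, G.cfValue x i J a * (z i J a - x i J a)
      = -∑ i, ∑ J, G.toSeq x i (G.parent i J) *
        ∑ a, G.cfValue z i J a * (x i J a - z i J a) := by
    simp only [sum_toSeq_mul_cfValue]
    exact G.sum_grad_mul_sub_comm _ _
  have h1 : ∑ i, ∑ J, G.toSeq x i (G.parent i J) * ∑ a, G.cfValue z i J a * (x i J a - z i J a)
      ≤ ∑ i, ∑ J, G.toSeq x i (G.parent i J) *
        -(μ * ∑ a, (xr i J a - z i J a) * (x i J a - z i J a)) := by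
    refine Finset.sum_le_sum fun i _ => Finset.sum_le_sum fun J _ =>
      mul_le_mul_of_nonneg_left ?_ (G.toSeq_pos hε hx i _).le
    rw [← sub_nonpos]
    refine le_of_eq_of_le ?_ (hvi i J (x i J) (hx i J))
    rw [sub_neg_eq_add, Finset.mul_sum, ← Finset.sum_add_distrib]
    exact Finset.sum_congr rfl fun a _ => by rw [rtValue]; ring
  have h2 : ∀ i J, (G.toSeq z i (G.parent i J) - G.toSeq x i (G.parent i J)) *
      ∑ a, (xr i J a - z i J a) * (x i J a - z i J a)
      ≤ L i (G.parent i J) * (Fintype.card (A i J) : ℝ) * (‖xr - z‖ * s ^ 2) := by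
    intro i J
    refine (le_abs_self _).trans ?_
    rw [abs_mul]
    have hw := hL i (G.parent i J) z hz x hx
    rw [norm_sub_rev] at hw
    have hin : |∑ a, (xr i J a - z i J a) * (x i J a - z i J a)|
        ≤ (Fintype.card (A i J) : ℝ) * (‖xr - z‖ * s) := by
      refine (Finset.abs_sum_le_sum_abs _ _).trans ?_
      rw [← nsmul_eq_mul, ← Finset.card_univ, ← Finset.sum_const]
      refine Finset.sum_le_sum fun a _ => ?_
      rw [abs_mul]
      exact mul_le_mul (abs_apply_sub_le_norm _ _ i J a) (abs_apply_sub_le_norm _ _ i J a)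
        (abs_nonneg _) (norm_nonneg _)
    refine (mul_le_mul hw hin (abs_nonneg _) (mul_nonneg (hL0 _ _) hs0)).trans_eq ?_
    ring
  have h3 : ∑ i, ∑ J, (G.toSeq z i (G.parent i J) - G.toSeq x i (G.parent i J)) *
      ∑ a, (xr i J a - z i J a) * (x i J a - z i J a) ≤ m / 2 * s ^ 2 := by
    calc _ ≤ ∑ i, ∑ J, L i (G.parent i J) * (Fintype.card (A i J) : ℝ) * (‖xr - z‖ * s ^ 2) :=
          Finset.sum_le_sum fun i _ => Finset.sum_le_sum fun J _ => h2 i J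
      _ = N * ‖xr - z‖ * s ^ 2 := by simp only [hN, Finset.sum_mul]; simp only [mul_assoc]
      _ ≤ m / 2 * s ^ 2 := by
          refine mul_le_mul_of_nonneg_right ?_ (sq_nonneg s)
          rw [le_div_iff₀ (by positivity)] at hρ
          nlinarith [norm_nonneg (xr - z)]
  have h4 := G.mul_sq_norm_sub_le_weightedSqDist hε hm hz (hlow z hz) x z
  have h5 : ∑ i, ∑ J, G.toSeq z i (G.parent i J) *
        ∑ a, G.rtValue μ xr x i J a * (z i J a - x i J a)
      = ∑ i, ∑ J, G.toSeq z i (G.parent i J) * ∑ a, G.cfValue x i J a * (z i J a - x i J a)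
        + ∑ i, ∑ J, G.toSeq x i (G.parent i J) *
          -(μ * ∑ a, (xr i J a - z i J a) * (x i J a - z i J a))
        + μ * (G.weightedSqDist z x z
          - ∑ i, ∑ J, (G.toSeq z i (G.parent i J) - G.toSeq x i (G.parent i J)) *
            ∑ a, (xr i J a - z i J a) * (x i J a - z i J a)) := by
    have hloc : ∀ i J, ∑ a, G.rtValue μ xr x i J a * (z i J a - x i J a)
        = ∑ a, G.cfValue x i J a * (z i J a - x i J a)
          - μ * ∑ a, (xr i J a - z i J a) * (x i J a - z i J a)
          + μ * ∑ a, (x i J a - z i J a) ^ 2 := by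
      intro i J
      simp only [Finset.mul_sum, ← Finset.sum_sub_distrib, ← Finset.sum_add_distrib, rtValue]
      exact Finset.sum_congr rfl fun a _ => by ring
    simp only [hloc, weightedSqDist]
    rw [← Finset.sum_sub_distrib, Finset.mul_sum, ← Finset.sum_add_distrib,
      ← Finset.sum_add_distrib]
    refine Finset.sum_congr rfl fun i _ => ?_
    rw [← Finset.sum_sub_distrib, Finset.mul_sum, ← Finset.sum_add_distrib,
      ← Finset.sum_add_distrib]
    exact Finset.sum_congr rfl fun J _ => by ring
  rw [h5, hswap]
  nlinarith

/-- Last-iterate convergence of one block whose reference is close to its saddle point. -/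
theorem exists_tendsto_play [∀ i J, Nonempty (A i J)] (G : EFG A) {ε μ : ℝ} (hε : 0 < ε)
    (hcard : ∀ i J, (Fintype.card (A i J) : ℝ) * ε ≤ 1) (hμ : 0 < μ) :
    ∃ ρ > 0, ∀ xr z : LocalProfile A, z ∈ behavSet A ε → G.LocalVI ε μ xr z → ‖xr - z‖ ≤ ρ →
      ∀ rule : RegretRule, rule.Admissible → ∀ R0 : LocalProfile A,
        Tendsto (fun t => play ε (G.regrets rule ε μ xr R0 t)) atTop (𝓝 z) := by
  obtain ⟨ρ, hρ, c, hc, hstrong⟩ := G.exists_strong_localVI hε hμ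
  refine ⟨ρ, hρ, fun xr z hz hvi hclose rule hrule R0 => ?_⟩
  obtain ⟨d, hd0, hds, hd⟩ := hrule.exists_discount
  choose y hy0 hy1 hyz using fun i J => exists_basisMatrix_mulVec_eq (hcard i J) (hz i J)
  choose L _ hL using fun i J j =>
    exists_lipschitz_behavSet hε (G.contDiff_vertexRegret ε μ xr i J j)
  choose M hM using fun i J j => (isCompact_behavSet (A := A) hε).exists_bound_of_continuousOn
    (G.contDiff_vertexRegret ε μ xr i J j).continuous.continuousOn
  set R := G.regrets rule ε μ xr R0 with hR
  have hx : ∀ t, play ε (R t) ∈ behavSet A ε := fun t => play_mem hcard (R t)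
  have hRs : ∀ t i J j, R (t + 1) i J j
      = rule.update (t + 1) (R t i J j + G.vertexRegret ε μ xr (play ε (R t)) i J j) := by
    intro t i J j
    rw [← instRegret_eq_vertexRegret]
    rfl
  have hrs : ∀ i J j, G.vertexRegret ε μ xr z i J j ≤ 0 := fun i J j =>
    hvi i J _ (basisMatrix_col_mem (hcard i J) j)
  have hcompl : ∀ i J j, y i J j * G.vertexRegret ε μ xr z i J j = 0 := by
    intro i J j
    have h := G.sum_mul_vertexRegret ε μ xr z i J (hy1 i J)
    simp only [hyz, sub_self, mul_zero, Finset.sum_const_zero] at h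
    exact (Finset.sum_eq_zero_iff_of_nonpos fun j _ =>
      mul_nonpos_of_nonneg_of_nonpos (hy0 i J j) (hrs i J j)).1 h j (Finset.mem_univ j)
  have hsum : Summable fun t => ‖play ε (R t) - z‖ ^ 2 := by
    refine summable_sq_of_regret_dynamics (ι := Σ i, Σ J : I i, A i J)
      (w := fun j => G.toSeq z j.1 (G.parent j.1 j.2.1)) (xh := fun j => y j.1 j.2.1 j.2.2)
      (rs := fun j => G.vertexRegret ε μ xr z j.1 j.2.1 j.2.2)
      (L := fun j => L j.1 j.2.1 j.2.2) (M := fun j => M j.1 j.2.1 j.2.2)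
      (R := fun t j => R t j.1 j.2.1 j.2.2)
      (r := fun t j => G.vertexRegret ε μ xr (play ε (R t)) j.1 j.2.1 j.2.2)
      (d := d) (c := c) (fun j => (G.toSeq_pos hε hz _ _).le) (fun j => hy0 _ _ _)
      (fun j => ?_) (fun j => hrs _ _ _) (fun j => hcompl _ _ _)
      (fun t j => hM _ _ _ _ (hx t)) (fun t j => hL _ _ _ _ (hx t) _ hz) hd0 hds
      (fun t j => ?_) (fun t j => ?_) (fun t => ?_) hc (fun t => ?_)
    · rw [← hy1 j.1 j.2.1]
      exact Finset.single_le_sum (fun b _ => hy0 _ _ b) (Finset.mem_univ j.2.2)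
    · rw [hRs]
      exact (hd t _).1
    · rw [hRs]
      exact (hd t _).2
    · rw [Fintype.sum_sigma]
      refine Finset.sum_eq_zero fun i _ => ?_
      rw [Fintype.sum_sigma]
      refine Finset.sum_eq_zero fun J _ => ?_
      dsimp only
      rw [← Finset.mul_sum, sum_max_mul_vertexRegret, mul_zero]
    · refine (hstrong xr z _ hz (hx t) hvi hclose).trans_eq ?_
      rw [Fintype.sum_sigma]
      refine Finset.sum_congr rfl fun i _ => ?_
      rw [Fintype.sum_sigma]
      refine Finset.sum_congr rfl fun J _ => ?_
      dsimp only
      rw [← Finset.mul_sum, sum_mul_vertexRegret _ _ _ _ _ _ _ (hy1 i J), hyz]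
  have h0 : Tendsto (fun t => play ε (R t) - z) atTop (𝓝 0) := by
    rw [tendsto_zero_iff_norm_tendsto_zero]
    simpa [Real.sqrt_sq (norm_nonneg _)] using hsum.tendsto_atTop_zero.sqrt
  simpa using h0.add_const z

end EFG

/-! ### Last-iterate convergence -/

theorem theorem4 {I : Fin 2 → Type*} {A : (i : Fin 2) → I i → Type*}
    [∀ i, Fintype (I i)] [∀ i J, Fintype (A i J)] [∀ i J, Nonempty (A i J)]
    (G : EFG A) (ε μ : ℝ) (hε : 0 < ε)
    (hcard : ∀ i J, (Fintype.card (A i J) : ℝ) * ε ≤ 1) (hμ : 0 < μ)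
    (qr qs : ℕ → SeqProfile A)
    (hqr : ∀ n, G.IsProfile ε (qr n))
    (hqs : ∀ n, G.IsRTSaddle ε μ (qr n) (qs n))
    (hreset : Summable fun n => profileDist (qr (n + 1)) (qs n)) :
    Bornology.IsBounded (Set.range qs) ∧
    ∃ q : SeqProfile A, G.IsEFPE ε q ∧ Tendsto qs atTop (𝓝 q) ∧
      ∀ rule : RegretRule, rule.Admissible → ∀ R0 : ℕ → LocalProfile A,
        (∀ᶠ n in atTop,
          Tendsto (fun t => G.iterate rule ε μ (qr n) (R0 n) t) atTop (𝓝 (qs n))) ∧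
        ∀ η > 0, ∃ N, ∀ n ≥ N, ∃ T₀, ∀ t ≥ T₀,
          profileDist (G.iterate rule ε μ (qr n) (R0 n) t) q < η := by
  obtain ⟨C, hC0, hC⟩ := G.exists_lipschitz_toBehav hε
  have hvi := fun n => (hqs n).localVI hε hμ
  have hs := fun n => G.toBehav_mem hε (hqs n).1
  obtain ⟨z, hz, hE, hlim, hdiff⟩ := G.exists_tendsto_of_localVI hε hμ
    (fun n => G.toBehav_mem hε (hqr n)) hs hvi (hreset.mul_left C)
    fun n => hC _ _ (hqr (n + 1)) (hqs n).1
  have htoSeq : Continuous G.toSeq := continuous_pi fun i => continuous_pi fun σ =>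
    (G.contDiff_toSeq i σ).continuous
  have hqlim : Tendsto qs atTop (𝓝 (G.toSeq z)) :=
    ((htoSeq.tendsto z).comp hlim).congr fun n => G.toSeq_toBehav hε (hqs n).1
  refine ⟨Metric.isBounded_range_of_tendsto qs hqlim, G.toSeq z, hE, hqlim,
    fun rule hrule R0 => ?_⟩
  obtain ⟨ρ, hρ, hblock⟩ := G.exists_tendsto_play hε hcard hμ
  have hiter : ∀ᶠ n in atTop,
      Tendsto (fun t => G.iterate rule ε μ (qr n) (R0 n) t) atTop (𝓝 (qs n)) := by
    filter_upwards [(tendsto_zero_iff_norm_tendsto_zero.1 hdiff).eventually (ge_mem_nhds hρ)]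
      with n hn
    have h := (htoSeq.tendsto _).comp (hblock _ _ (hs n) (hvi n) hn rule hrule (R0 n))
    rwa [G.toSeq_toBehav hε (hqs n).1] at h
  refine ⟨hiter, fun η hη => ?_⟩
  have hcont : Continuous fun p : SeqProfile A => profileDist p (G.toSeq z) := by
    unfold profileDist
    fun_prop
  have hopen : IsOpen {p : SeqProfile A | profileDist p (G.toSeq z) < η} :=
    isOpen_lt hcont continuous_const
  have hmem : G.toSeq z ∈ {p : SeqProfile A | profileDist p (G.toSeq z) < η} := by
    simpa [profileDist] using hη
  obtain ⟨N, hN⟩ := eventually_atTop.1 (hiter.and (hqlim.eventually (hopen.mem_nhds hmem)))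
  refine ⟨N, fun n hn => ?_⟩
  exact eventually_atTop.1 ((hN n hn).1.eventually (hopen.mem_nhds (hN n hn).2))
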